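/- Let $n\ge 1$ and $0<\lambda<n$. Cubes $Q\subset\mathbb R^n$ have sides parallel to the coordinate axes, and $|Q|$ is the Lebesgue measure of $Q$. For a measurable $f:\mathbb R^n\to[-\infty,\infty]$ put $$Mf(x)=\sup_{Q\ni x}\frac1{|Q|}\int_Q|f|,\qquad [M,b]f(x)=M(bf)(x)-b(x)\,Mf(x),$$ where $b:\mathbb R^n\to\mathbb R$ is measurable, and let $$\|f\|_{\mathcal M_{L(1+\log^+L),\lambda}}=\sup_Q|Q|^{\lambda/n}\,\inf\Big\{\alpha>0:\ \frac1{|Q|}\int_Q\frac{|f(x)|}{\alpha}\Big(1+\log^+\frac{|f(x)|}{\alpha}\Big)dx\le1\Big\};$$ $\mathcal M_{L(1+\log^+L),\lambda}$ is the set of measurable $f$ for which this is finite. Say that $f$ is radially decreasing if $f(x)=\varphi(|x|)$ for $x\ne0$ with a non-increasing function $\varphi:(0,\infty)\to[-\infty,\infty]$. A locally integrable $b$ belongs to $\mathrm{BMO}(\mathbb R^n)$ if $\|b\|_*=\sup_Q\frac1{|Q|}\int_Q|b-b_Q|<\infty$, where $b_Q=\frac1{|Q|}\int_Qb$. Write $b^+=\max\{b,0\}$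 and $b^-=\max\{-b,0\}$. Theorem. There is a constant $c>0$, depending only on $n$ and $\lambda$, such that for every $b\in\mathrm{BMO}(\mathbb R^n)$ with $b^-\in L_\infty(\mathbb R^n)$ and every radially decreasing $f\in\mathcal M_{L(1+\log^+L),\lambda}$ one has $[M,b]f\in\mathcal M_{L(1+\log^+L),\lambda}$ and $$\|[M,b]f\|_{\mathcal M_{L(1+\log^+L),\lambda}}\le c\,\big(\|b^+\|_*+\|b^-\|_{L_\infty}\big)\,\|f\|_{\mathcal M_{L(1+\log^+L),\lambda}}.$$ -/

import Mathlib

open MeasureTheory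
open scoped ENNReal

/-- The open cube in `ℝⁿ` with centre `a`, side length `2 * r` and sides parallel to the axes.
(All quantities below are the same for open and for closed cubes.) -/
def axisCube {n : ℕ} (a : EuclideanSpace ℝ (Fin n)) (r : ℝ) : Set (EuclideanSpace ℝ (Fin n)) :=
  {y | ∀ i, |y i - a i| < r}

/-- The Hardy–Littlewood maximal function `Mf(x) = sup_{Q ∋ x} |Q|⁻¹ ∫_Q |f|`, the supremum being
over all cubes `Q` that contain `x`. -/
noncomputable def cubeMaximal {n : ℕ} (f : EuclideanSpace ℝ (Fin n) → EReal)
    (x : EuclideanSpace ℝ (Fin n)) : ℝ≥0∞ :=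
  ⨆ (a : EuclideanSpace ℝ (Fin n)) (r : ℝ) (_ : 0 < r) (_ : x ∈ axisCube a r),
    ⨍⁻ y in axisCube a r, (f y).abs ∂volume

/-- The commutator `[M,b]f(x) = M(bf)(x) - b(x) Mf(x)`, with values in `[-∞,∞]`. At points where
this reads `∞ - ∞` the value is `-∞`, so its modulus is `∞`. -/
noncomputable def maximalCommutator {n : ℕ} (b : EuclideanSpace ℝ (Fin n) → ℝ)
    (f : EuclideanSpace ℝ (Fin n) → EReal) (x : EuclideanSpace ℝ (Fin n)) : EReal :=
  (cubeMaximal (fun y => (b y : EReal) * f y) x : EReal) -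
    (b x : EReal) * (cubeMaximal f x : EReal)

/-- The seminorm `‖b‖_* = sup_Q |Q|⁻¹ ∫_Q |b - b_Q|`, where `b_Q` is the mean of `b` over `Q`. -/
noncomputable def bmoSeminorm {n : ℕ} (b : EuclideanSpace ℝ (Fin n) → ℝ) : ℝ≥0∞ :=
  ⨆ (a : EuclideanSpace ℝ (Fin n)) (r : ℝ) (_ : 0 < r),
    ⨍⁻ y in axisCube a r, ‖b y - ⨍ z in axisCube a r, b z‖ₑ ∂volume

/-- `b ∈ BMO(ℝⁿ)`. -/
def MemBMO {n : ℕ} (b : EuclideanSpace ℝ (Fin n) → ℝ) : Prop :=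
  LocallyIntegrable b ∧ bmoSeminorm b < ∞

/-- `Φ(t) = t (1 + log⁺ t)` on `[0,∞]`, with `Φ(0) = 0` and `Φ(∞) = ∞`. The map
`EReal.toENNReal` sends negative numbers to `0`, so it turns `log` into `log⁺`. -/
noncomputable def zygmundYoung (t : ℝ≥0∞) : ℝ≥0∞ :=
  t * (1 + (ENNReal.log t).toENNReal)

/-- The Luxemburg average
`‖g‖_{L(1+log⁺L),Q} = inf {α > 0 : |Q|⁻¹ ∫_Q Φ(|g|/α) ≤ 1}` (it is `∞` if there is no such `α`). -/
noncomputable def zygmundAverage {n : ℕ} (g : EuclideanSpace ℝ (Fin n) → EReal)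
    (Q : Set (EuclideanSpace ℝ (Fin n))) : ℝ≥0∞ :=
  sInf {α : ℝ≥0∞ | 0 < α ∧ α < ∞ ∧ ⨍⁻ x in Q, zygmundYoung ((g x).abs / α) ∂volume ≤ 1}

/-- The Zygmund–Morrey norm `sup_Q |Q|^{lam/n} ‖g‖_{L(1+log⁺L),Q}`. -/
noncomputable def zygmundMorreyNorm {n : ℕ} (lam : ℝ)
    (g : EuclideanSpace ℝ (Fin n) → EReal) : ℝ≥0∞ :=
  ⨆ (a : EuclideanSpace ℝ (Fin n)) (r : ℝ) (_ : 0 < r),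
    volume (axisCube a r) ^ (lam / (n : ℝ)) * zygmundAverage g (axisCube a r)

/-- Membership in the Zygmund–Morrey space: (Lebesgue) measurable and of finite norm. -/
def MemZygmundMorrey {n : ℕ} (lam : ℝ) (g : EuclideanSpace ℝ (Fin n) → EReal) : Prop :=
  AEMeasurable g ∧ zygmundMorreyNorm lam g < ∞

/-- `f(x) = φ(|x|)` for a non-increasing `φ` on `(0,∞)`, where `|x|` is the Euclidean norm; the
value at the origin is arbitrary. Such an `f` is automatically measurable. -/
def IsRadiallyDecreasing {n : ℕ} (f : EuclideanSpace ℝ (Fin n) → EReal) : Prop :=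
  ∃ φ : ℝ → EReal, AntitoneOn φ (Set.Ioi 0) ∧ ∀ x, x ≠ 0 → f x = φ ‖x‖

open Metric Module Filter Topology Set

/-! A radially decreasing `f` of finite norm `N` satisfies `|f(x)| ≤ C N |x|^(-lam)`
(`IsRadiallyDecreasing.abs_le`), so only this power weight matters. Weak `L^(n/lam)` embeds into the
target space because `n/lam > 1` (`exists_zygmundMorreyNorm_le_of_measure_lt_le`), so it suffices to
place the commutator in weak `L^(n/lam)`.

The maximal function sees only `|b|`. Hence `|[M,b]f(x)|` is at most the supremum of the means of
`||b(y)| - |b(x)|| |f(y)|` plus `2 b⁻(x) Mf(x)` (`abs_maximalCommutator_le`). The contributions of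
`b⁻` are harmless, since the maximal function of the weight is dominated by the weight. There remain
the means of `|β(y) - β(x)| |y|^(-lam)` with `β = b⁺`. They are at most `K (τ + 1) D |x|^(-lam)`
unless `x` lies in the set of large oscillation at level `τ` of a ball `B(0, ρ)` with `|x| < ρ ≤
2|x|` (`exists_lintegral_enorm_sub_mul_rpow_le`).

A John–Nirenberg argument shows that these sets decay faster than any power of `τ`
(`exists_measure_largeOscillationSet_le_div_pow`). On the shell `|x| ~ 2^j ρ₀` the level `τ = 2^(lam
j)` is just offset by the decay of the weight, and the exceptional sets have summable measure
(`exists_measure_lt_le_of_forall_notMem`). -/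

lemma ball_subset_ball_three {E : Type*} [SeminormedAddCommGroup E] {a z x : E} {r R : ℝ}
    (hx : x ∈ ball a R) (hxz : x ∈ ball z r)
    (hr : r ≤ R) : ball z r ⊆ ball a (3 * R) := by
  intro y hy
  rw [mem_ball] at *
  have h1 := dist_triangle y z a
  have h2 := dist_triangle z x a
  rw [dist_comm z x] at h2
  linarith

/-- Comparison of two constants over a common set. -/
lemma enorm_sub_mul_measure_le {E : Type*} [MeasurableSpace E] {μ : Measure E}
    {β : E → ℝ} (hβ : AEMeasurable β μ) (s : Set E) (u v : ℝ) :
    ‖u - v‖ₑ * μ s ≤ ∫⁻ y in s, ‖β y - u‖ₑ ∂μ + ∫⁻ y in s, ‖β y - v‖ₑ ∂μ := by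
  rw [← lintegral_add_left' (by exact (hβ.restrict.sub_const u).enorm),
    ← setLIntegral_const]
  refine lintegral_mono fun y => ?_
  have : u - v = (β y - v) - (β y - u) := by ring
  rw [this, add_comm]
  exact enorm_sub_le

lemma lintegral_enorm_sub_le_add {E : Type*} [MeasurableSpace E] {μ : Measure E}
    (β : E → ℝ) (s : Set E) (u v : ℝ) :
    ∫⁻ y in s, ‖β y - u‖ₑ ∂μ ≤ ∫⁻ y in s, ‖β y - v‖ₑ ∂μ + ‖v - u‖ₑ * μ s := by
  rw [← setLIntegral_const, ← lintegral_add_right _ measurable_const]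
  refine lintegral_mono fun y => ?_
  have : β y - u = (β y - v) + (v - u) := by ring
  rw [this]
  exact enorm_add_le _ _

/-- The points of `B(a, R)` that lie in a ball of radius at most `R` over which the mean of
`|β - c a (3R)|` exceeds `τ * D`. -/
def largeOscillationSet {E : Type*} [PseudoMetricSpace E] [MeasurableSpace E]
    (μ : Measure E) (β : E → ℝ) (c : E → ℝ → ℝ) (D : ℝ≥0∞) (a : E) (R : ℝ) (τ : ℝ≥0∞) : Set E :=
  {x | x ∈ ball a R ∧ ∃ z r, 0 < r ∧ r ≤ R ∧ x ∈ ball z r ∧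
    τ * D * μ (ball z r) < ∫⁻ y in ball z r, ‖β y - c a (3 * R)‖ₑ ∂μ}

lemma largeOscillationSet_anti {E : Type*} [PseudoMetricSpace E] [MeasurableSpace E]
    {μ : Measure E} {β : E → ℝ} {c : E → ℝ → ℝ} {D : ℝ≥0∞} {a : E} {R : ℝ} {τ τ' : ℝ≥0∞} (h : τ ≤ τ') :
    largeOscillationSet μ β c D a R τ' ⊆ largeOscillationSet μ β c D a R τ := by
  rintro x ⟨hx, z, r, h1, h2, h3, h4⟩
  exact ⟨hx, z, r, h1, h2, h3, lt_of_le_of_lt (by gcongr) h4⟩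

/-! ### John–Nirenberg decay of the sets of large oscillation. -/

section MeanOscillation

variable {E : Type*} [NormedAddCommGroup E] [NormedSpace ℝ E] [FiniteDimensional ℝ E]
  [MeasurableSpace E] [BorelSpace E] {μ : Measure E} [μ.IsAddHaarMeasure]

/-- `c a r` is a constant for which `|β - c a r|` has mean at most `D` over the ball `B(a, r)`. -/
def HasMeanOscillation (μ : Measure E) (β : E → ℝ) (c : E → ℝ → ℝ) (D : ℝ≥0∞) : Prop :=
  ∀ a r, 0 < r → ∫⁻ y in ball a r, ‖β y - c a r‖ₑ ∂μ ≤ D * μ (ball a r)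

lemma measure_ball_mul_left (a b : E) {k : ℝ} (hk : 0 < k) (r : ℝ) :
    μ (ball a (k * r)) = ENNReal.ofReal (k ^ finrank ℝ E) * μ (ball b r) := by
  rw [Measure.addHaar_ball_mul_of_pos μ a hk, Measure.addHaar_ball_center μ b]

/-- Calderón–Zygmund step with Vitali balls. Balls with mean above `T * D` have small total measure,
and a high level relative to `c a (3R)` forces level `τ` relative to the constant of a selected ball
enlarged 15 times, so the hypothesis applies on its 5-fold enlargement. -/
lemma measure_largeOscillationSet_step {β : E → ℝ} {c : E → ℝ → ℝ} {D : ℝ≥0∞}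
    (hβ : AEMeasurable β μ) (h : HasMeanOscillation μ β c D) (hD0 : D ≠ 0) (hD : D ≠ ∞)
    {τ q : ℝ≥0∞}
    (hq : ∀ a R, 0 < R → μ (largeOscillationSet μ β c D a R τ) ≤ q * μ (ball a R))
    (a : E) (R : ℝ) (hR : 0 < R) :
    μ (largeOscillationSet μ β c D a R
      (τ + (ENNReal.ofReal (2 * 45 ^ finrank ℝ E) + 1))) ≤ q * 2⁻¹ * μ (ball a R) := by
  set d := finrank ℝ E with hd
  set T : ℝ≥0∞ := ENNReal.ofReal (2 * 45 ^ d) with hT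
  set c₀ := c a (3 * R) with hc₀
  have hTpos : T ≠ 0 := by simp [hT]
  have hTtop : T ≠ ∞ := ENNReal.ofReal_ne_top
  -- the family of balls with large mean
  let I : Set (E × ℝ) := {p | 0 < p.2 ∧ p.2 ≤ R ∧ (ball p.1 p.2 ∩ ball a R).Nonempty ∧
    T * D * μ (ball p.1 p.2) < ∫⁻ y in ball p.1 p.2, ‖β y - c₀‖ₑ ∂μ}
  have hIsub : ∀ p ∈ I, ball p.1 p.2 ⊆ ball a (3 * R) := by
    rintro p ⟨-, h2, ⟨x, hx1, hx2⟩, -⟩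
    exact ball_subset_ball_three hx2 hx1 h2
  -- A larger ball would have volume comparable to `B(a, 3R)`, where `45 = 3 * 15`. The bound leaves
  -- room for the 15-fold enlargement to have radius at most `R`.
  have hIsmall : ∀ p ∈ I, p.2 ≤ R / 15 := by
    intro p hp
    by_contra! hcon
    have h1 : T * D * μ (ball p.1 p.2) < D * μ (ball a (3 * R)) :=
      hp.2.2.2.trans_le ((lintegral_mono_set (hIsub p hp)).trans (h a (3 * R) (by positivity)))
    have h2 : μ (ball a (3 * R)) ≤ T * μ (ball p.1 p.2) := by
      calc μ (ball a (3 * R)) = ENNReal.ofReal (45 ^ d) * μ (ball p.1 (R / 15)) := by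
            rw [← measure_ball_mul_left a p.1 (by norm_num)]; congr 2; ring
        _ ≤ T * μ (ball p.1 p.2) := by
            gcongr
            · refine ENNReal.ofReal_le_ofReal ?_
              have : (0 : ℝ) < 45 ^ d := by positivity
              linarith
    have h3 : D * μ (ball a (3 * R)) ≤ T * D * μ (ball p.1 p.2) := by
      rw [mul_comm T D, mul_assoc]; gcongr
    exact absurd h1 (not_lt.2 h3)
  obtain ⟨u, huI, hudisj, hucov⟩ := Vitali.exists_disjoint_subfamily_covering_enlargement
    (fun p : E × ℝ => ball p.1 p.2) I (fun p => p.2) 2 one_lt_two (fun p hp => hp.1.le) R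
    (fun p hp => hp.2.1) (fun p hp => nonempty_ball.2 hp.1)
  have hucount : u.Countable := hudisj.countable_of_isOpen (fun _ _ => isOpen_ball)
    (fun p hp => nonempty_ball.2 (huI hp).1)
  have hcover : largeOscillationSet μ β c D a R (τ + (T + 1)) ⊆
      ⋃ p ∈ u, largeOscillationSet μ β c D p.1 (5 * p.2) τ := by
    rintro x ⟨hxa, z', r', hr'0, hr'R, hxz', hbig⟩
    have hmemI : ∀ z r, 0 < r → r ≤ R → x ∈ ball z r →
        T * D * μ (ball z r) < ∫⁻ y in ball z r, ‖β y - c₀‖ₑ ∂μ → (z, r) ∈ I :=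
      fun z r h1 h2 h3 h4 => ⟨h1, h2, ⟨x, h3, hxa⟩, h4⟩
    have hI' : (z', r') ∈ I := by
      refine hmemI z' r' hr'0 hr'R hxz' (lt_of_le_of_lt ?_ hbig)
      gcongr
      exact le_self_add.trans le_add_self
    -- a ball of almost maximal radius
    let J : Set ℝ := {r | ∃ z, x ∈ ball z r ∧ (z, r) ∈ I}
    have hJne : J.Nonempty := ⟨r', z', hxz', hI'⟩
    have hJbdd : BddAbove J := ⟨R, by rintro r ⟨z, -, hz⟩; exact hz.2.1⟩
    have hJpos : 0 < sSup J := hr'0.trans_le (le_csSup hJbdd ⟨z', hxz', hI'⟩)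
    obtain ⟨r₁, ⟨z₁, hxz₁, hI₁⟩, hr₁⟩ := exists_lt_of_lt_csSup hJne (half_lt_self hJpos)
    have hmax : ∀ z r, x ∈ ball z r → (z, r) ∈ I → r ≤ 2 * r₁ := by
      intro z r hz hzI
      have := le_csSup hJbdd (show r ∈ J from ⟨z, hz, hzI⟩)
      linarith
    obtain ⟨p, hpu, ⟨w, hw1, hw2⟩, hp2⟩ := hucov (z₁, r₁) hI₁
    have hpI := huI hpu
    have hpsmall := hIsmall p hpI
    have hp0 : 0 < p.2 := hpI.1
    simp only at hp2 hw1
    have hr₁0 : 0 < r₁ := hI₁.1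
    have hxp : x ∈ ball p.1 (5 * p.2) := by
      rw [mem_ball] at *
      have h1 := dist_triangle x z₁ p.1
      have h2 := dist_triangle z₁ w p.1
      rw [dist_comm z₁ w] at h2
      linarith
    refine mem_iUnion₂.2 ⟨p, hpu, hxp, z', r', hr'0, ?_, hxz', ?_⟩
    · have := hmax z' r' hxz' hI'
      linarith
    -- Were this mean larger, the 15-fold ball would itself belong to the family, giving `15 p.2 ≤ 2
    -- r₁ ≤ 4 p.2`.
    have hmid : ∫⁻ y in ball p.1 (15 * p.2), ‖β y - c₀‖ₑ ∂μ ≤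
        T * D * μ (ball p.1 (15 * p.2)) := by
      by_contra! hcon
      have hx15 : x ∈ ball p.1 (15 * p.2) := ball_subset_ball (by linarith) hxp
      have := hmax _ _ hx15 (hmemI _ _ (by linarith) (by linarith) hx15 hcon)
      linarith
    have hconst : ‖c p.1 (15 * p.2) - c₀‖ₑ ≤ (T + 1) * D := by
      have h1 := enorm_sub_mul_measure_le hβ (ball p.1 (15 * p.2)) (c p.1 (15 * p.2)) c₀
      have h2 := h1.trans (add_le_add (h p.1 (15 * p.2) (by linarith)) hmid)
      rw [← add_mul] at h2
      have h0 : μ (ball p.1 (15 * p.2)) ≠ 0 := (measure_ball_pos _ _ (by linarith)).ne'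
      have h3 := (ENNReal.mul_le_mul_iff_left h0 measure_ball_lt_top.ne).1 h2
      rwa [add_mul, one_mul, add_comm]
    have h15 : 3 * (5 * p.2) = 15 * p.2 := by ring
    rw [h15]
    -- Passing from `c₀` to the new constant costs exactly the surplus `T + 1` of the level.
    have h4 : (τ + (T + 1)) * D * μ (ball z' r') <
        ∫⁻ y in ball z' r', ‖β y - c p.1 (15 * p.2)‖ₑ ∂μ + (T + 1) * D * μ (ball z' r') :=
      hbig.trans_le ((lintegral_enorm_sub_le_add β _ _ (c p.1 (15 * p.2))).trans (by gcongr))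
    rw [add_mul, add_mul] at h4
    exact lt_of_add_lt_add_right h4
  have hsum : T * ∑' p : u, μ (ball p.1.1 p.1.2) ≤ ENNReal.ofReal (3 ^ d) * μ (ball a R) := by
    have hmeas : ∀ p ∈ u, MeasurableSet (ball p.1 p.2) := fun _ _ => measurableSet_ball
    have h1 : T * D * ∑' p : u, μ (ball p.1.1 p.1.2) ≤ D * μ (ball a (3 * R)) := by
      calc T * D * ∑' p : u, μ (ball p.1.1 p.1.2)
          = ∑' p : u, T * D * μ (ball p.1.1 p.1.2) := ENNReal.tsum_mul_left.symm
        _ ≤ ∑' p : u, ∫⁻ y in ball p.1.1 p.1.2, ‖β y - c₀‖ₑ ∂μ :=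
            ENNReal.tsum_le_tsum fun p => (huI p.2).2.2.2.le
        _ = ∫⁻ y in ⋃ p ∈ u, ball p.1 p.2, ‖β y - c₀‖ₑ ∂μ :=
            (lintegral_biUnion hucount hmeas hudisj _).symm
        _ ≤ ∫⁻ y in ball a (3 * R), ‖β y - c₀‖ₑ ∂μ :=
            lintegral_mono_set (iUnion₂_subset fun p hp => hIsub p (huI hp))
        _ ≤ _ := h a (3 * R) (by positivity)
    rw [mul_comm T D, mul_assoc, ENNReal.mul_le_mul_iff_right hD0 hD] at h1
    rwa [measure_ball_mul_left a a (by norm_num)] at h1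
  calc μ (largeOscillationSet μ β c D a R (τ + (T + 1)))
      ≤ ∑' p : u, μ (largeOscillationSet μ β c D p.1.1 (5 * p.1.2) τ) :=
        (measure_mono hcover).trans (measure_biUnion_le μ hucount _)
    _ ≤ ∑' p : u, q * (ENNReal.ofReal (5 ^ d) * μ (ball p.1.1 p.1.2)) := by
        refine ENNReal.tsum_le_tsum fun p => ?_
        rw [← measure_ball_mul_left p.1.1 p.1.1 (by norm_num)]
        exact hq _ _ (by have := (huI p.2).1; linarith)
    _ = q * (ENNReal.ofReal (5 ^ d) * ∑' p : u, μ (ball p.1.1 p.1.2)) := by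
        rw [ENNReal.tsum_mul_left, ENNReal.tsum_mul_left]
    _ ≤ q * (2⁻¹ * μ (ball a R)) := by
        gcongr q * ?_
        rw [← ENNReal.mul_le_mul_iff_right hTpos hTtop, mul_left_comm]
        -- `45 = 5 * 3 * 3`: the 5-fold Vitali enlargement, the ball `B(a, 3R)`, and a factor `3 ^
        -- d` to spare.
        have hTe : T * (2⁻¹ * μ (ball a R)) =
            ENNReal.ofReal (5 ^ d) * (ENNReal.ofReal (3 ^ d) * 3 ^ d * μ (ball a R)) := by
          have : T * 2⁻¹ = ENNReal.ofReal (5 ^ d) * (ENNReal.ofReal (3 ^ d) * 3 ^ d) := by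
            rw [hT, ENNReal.ofReal_mul (by norm_num), mul_comm, ← mul_assoc]
            norm_num
            rw [ENNReal.inv_mul_cancel (by norm_num) (by norm_num), one_mul]
            rw [← mul_pow, ← mul_pow]
            norm_num
          rw [← mul_assoc, this, mul_assoc]
        rw [hTe]
        gcongr ENNReal.ofReal (5 ^ d) * ?_
        refine hsum.trans ?_
        gcongr
        exact le_mul_of_one_le_right' (one_le_pow₀ (by norm_num))
    _ = q * 2⁻¹ * μ (ball a R) := (mul_assoc _ _ _).symm

/-- **John–Nirenberg inequality** for the local maximal function of the oscillation. -/
lemma measure_largeOscillationSet_le {β : E → ℝ} {c : E → ℝ → ℝ} {D : ℝ≥0∞}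
    (hβ : AEMeasurable β μ) (h : HasMeanOscillation μ β c D) (hD0 : D ≠ 0) (hD : D ≠ ∞) (m : ℕ) :
    ∀ a R, 0 < R → μ (largeOscillationSet μ β c D a R
      (m * (ENNReal.ofReal (2 * 45 ^ finrank ℝ E) + 1))) ≤ 2⁻¹ ^ m * μ (ball a R) := by
  induction m with
  | zero => intro a R _; simpa using measure_mono fun x hx => hx.1
  | succ m ih =>
    intro a R hR
    have := measure_largeOscillationSet_step hβ h hD0 hD ih a R hR
    rwa [pow_succ, Nat.cast_succ, add_mul, one_mul]

/-- Exponential decay in `m = ⌊τ / L⌋` beats every power, since `m ^ s * 2⁻¹ ^ m` is bounded. -/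
lemma exists_measure_largeOscillationSet_le_div_pow (μ : Measure E) [μ.IsAddHaarMeasure] (s : ℕ) :
    ∃ K : ℝ, 0 < K ∧ ∀ (β : E → ℝ) (c : E → ℝ → ℝ) (D : ℝ≥0∞), AEMeasurable β μ →
      HasMeanOscillation μ β c D → D ≠ 0 → D ≠ ∞ → ∀ a R, 0 < R → ∀ τ : ℝ, 0 < τ →
        μ (largeOscillationSet μ β c D a R (ENNReal.ofReal τ)) ≤
          ENNReal.ofReal (K / τ ^ s) * μ (ball a R) := by
  set L : ℝ := 2 * 45 ^ finrank ℝ E + 1 with hL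
  have hL0 : 0 < L := by positivity
  have hlim := tendsto_pow_const_mul_const_pow_of_abs_lt_one s
    (show |(2⁻¹ : ℝ)| < 1 by norm_num [abs_of_pos])
  obtain ⟨C, hC⟩ := hlim.bddAbove_range
  have hC' : ∀ m : ℕ, (m : ℝ) ^ s * 2⁻¹ ^ m ≤ C := fun m => hC ⟨m, rfl⟩
  have hC1 : 0 < C := lt_of_lt_of_le (by norm_num) (hC' 1)
  refine ⟨2 * C * L ^ s, by positivity, fun β c D hβ h hD0 hD a R hR τ hτ => ?_⟩
  set m := ⌊τ / L⌋₊ with hm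
  have h1 : (m : ℝ) * L ≤ τ := by
    rw [← le_div_iff₀ hL0]; exact Nat.floor_le (by positivity)
  have h2 : τ ≤ (m + 1) * L := by
    rw [← div_le_iff₀ hL0]; exact (Nat.lt_floor_add_one _).le
  have h3 : (2⁻¹ : ℝ) ^ m ≤ 2 * C * L ^ s / τ ^ s := by
    rw [le_div_iff₀ (by positivity)]
    have h4 := hC' (m + 1)
    push_cast at h4
    rw [pow_succ (2⁻¹ : ℝ) m] at h4
    calc (2⁻¹ : ℝ) ^ m * τ ^ s ≤ 2⁻¹ ^ m * ((m + 1) * L) ^ s := by gcongr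
      _ = 2 * ((m + 1) ^ s * (2⁻¹ ^ m * 2⁻¹)) * L ^ s := by rw [mul_pow]; ring
      _ ≤ 2 * C * L ^ s := by gcongr
  have h5 : (m : ℝ≥0∞) * (ENNReal.ofReal (2 * 45 ^ finrank ℝ E) + 1) ≤ ENNReal.ofReal τ := by
    rw [← ENNReal.ofReal_one, ← ENNReal.ofReal_add (by positivity) zero_le_one, ← hL,
      ← ENNReal.ofReal_natCast, ← ENNReal.ofReal_mul (by positivity)]
    exact ENNReal.ofReal_le_ofReal h1
  refine (measure_mono (largeOscillationSet_anti h5)).trans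
    ((measure_largeOscillationSet_le hβ h hD0 hD m a R hR).trans ?_)
  gcongr
  refine le_trans (le_of_eq ?_) (ENNReal.ofReal_le_ofReal h3)
  rw [ENNReal.ofReal_pow (by norm_num), ENNReal.ofReal_inv_of_pos (by norm_num)]
  norm_num

end MeanOscillation

/-! ### Dyadic series and integration against power weights. -/

/-- The factor `1 + j` is the linear growth over dyadic scales, both of BMO constants and of `log⁺`.
-/
lemma ENNReal.tsum_one_add_mul_pow_ne_top {q : ℝ≥0∞} (hq : q < 1) :
    ∑' j : ℕ, (1 + (j : ℝ≥0∞)) * q ^ j ≠ ∞ := by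
  lift q to NNReal using hq.ne_top
  have hq' : q < 1 := by exact_mod_cast hq
  have h1 : Summable fun j : ℕ => (1 + (j : ℝ)) * (q : ℝ) ^ j := by
    have := (summable_geometric_of_lt_one q.2 (by exact_mod_cast hq')).add
      (summable_pow_mul_geometric_of_norm_lt_one 1
        (show ‖(q : ℝ)‖ < 1 by simpa using (by exact_mod_cast hq')))
    refine this.congr fun j => ?_
    simp only [NNReal.val_eq_coe]
    ring
  have h2 : Summable fun j : ℕ => (1 + (j : NNReal)) * q ^ j := by
    rw [← NNReal.summable_coe]; simpa using h1
  have := ENNReal.tsum_coe_ne_top_iff_summable.2 h2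
  simpa using this

lemma ENNReal.rpow_neg_le_rpow_neg {a b : ℝ≥0∞} (h : a ≤ b) {p : ℝ} (hp : 0 ≤ p) :
    b ^ (-p) ≤ a ^ (-p) := by
  rw [ENNReal.rpow_neg, ENNReal.rpow_neg]
  exact ENNReal.inv_le_inv.2 (ENNReal.rpow_le_rpow h hp)

section PowerWeight

variable {E : Type*} [NormedAddCommGroup E] [NormedSpace ℝ E] [FiniteDimensional ℝ E]
  [MeasurableSpace E] [BorelSpace E]

/-- Integration of a function whose means over centred balls are under control against a power
weight. -/
lemma exists_lintegral_mul_enorm_rpow_le (μ : Measure E) [μ.IsAddHaarMeasure] [Nontrivial E]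
    {lam : ℝ} (hlam : 0 < lam) (hlamn : lam < finrank ℝ E) :
    ∃ K : ℝ≥0∞, K ≠ ∞ ∧ ∀ (g : E → ℝ≥0∞) (A : ℝ≥0∞) (σ : ℝ), 0 < σ →
      (∀ j : ℕ, ∫⁻ y in ball 0 (σ / 2 ^ j), g y ∂μ ≤
        (1 + j) * A * μ (ball (0 : E) (σ / 2 ^ j))) →
      ∫⁻ y in ball 0 σ, g y * ‖y‖ₑ ^ (-lam) ∂μ ≤
        K * A * ENNReal.ofReal σ ^ (-lam) * μ (ball (0 : E) σ) := by
  set d := finrank ℝ E with hd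
  -- On the `j`-th shell the volume gains `2 ^ (-d j)` and the weight loses `2 ^ (lam j)`.
  set q : ℝ := 2 ^ (lam - d) with hq
  have hq1 : ENNReal.ofReal q < 1 := by
    rw [ENNReal.ofReal_lt_one]
    exact Real.rpow_lt_one_of_one_lt_of_neg one_lt_two (by linarith)
  refine ⟨ENNReal.ofReal (2 ^ lam) * ∑' j : ℕ, (1 + (j : ℝ≥0∞)) * ENNReal.ofReal q ^ j,
    ENNReal.mul_ne_top ENNReal.ofReal_ne_top (ENNReal.tsum_one_add_mul_pow_ne_top hq1), ?_⟩
  intro g A σ hσ hg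
  let S : ℕ → Set E := fun j => {y | σ / 2 ^ (j + 1) ≤ ‖y‖ ∧ ‖y‖ < σ / 2 ^ j}
  have hSm : ∀ j, MeasurableSet (S j) := fun j =>
    (measurableSet_le measurable_const measurable_norm).inter
      (measurableSet_lt measurable_norm measurable_const)
  have hcov : ball (0 : E) σ ⊆ {0} ∪ ⋃ j, S j := by
    intro y hy
    rw [mem_ball_zero_iff] at hy
    by_cases hy0 : y = 0
    · exact Or.inl hy0
    right
    have hny : 0 < ‖y‖ := norm_pos_iff.2 hy0
    obtain ⟨j, hj1, hj2⟩ := exists_nat_pow_near (show (1 : ℝ) ≤ σ / ‖y‖ by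
      rw [le_div_iff₀ hny]; linarith) one_lt_two
    rw [le_div_iff₀ hny] at hj1
    rw [div_lt_iff₀ hny] at hj2
    -- On a dyadic sphere `y` belongs to the previous shell, which is closed on its inner side.
    rcases hj1.eq_or_lt with he | hlt
    · rcases j with _ | j
      · simp at he; linarith
      refine mem_iUnion.2 ⟨j, ?_, ?_⟩
      · rw [div_le_iff₀ (by positivity)]; linarith
      · rw [lt_div_iff₀ (by positivity)]
        rw [pow_succ] at he
        nlinarith [pow_pos (two_pos : (0 : ℝ) < 2) j]
    · refine mem_iUnion.2 ⟨j, ?_, ?_⟩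
      · rw [div_le_iff₀ (by positivity)]; linarith
      · rw [lt_div_iff₀ (by positivity)]; linarith
  have hterm : ∀ j, ∫⁻ y in S j, g y * ‖y‖ₑ ^ (-lam) ∂μ ≤
      ENNReal.ofReal (2 ^ lam) * ((1 + j) * ENNReal.ofReal q ^ j) *
        (A * ENNReal.ofReal σ ^ (-lam) * μ (ball (0 : E) σ)) := by
    intro j
    have hσj : 0 < σ / 2 ^ (j + 1) := by positivity
    set k := ENNReal.ofReal (σ / 2 ^ (j + 1)) ^ (-lam) with hk
    have hktop : k ≠ ∞ := by
      rw [hk, ENNReal.ofReal_rpow_of_pos hσj]; exact ENNReal.ofReal_ne_top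
    calc ∫⁻ y in S j, g y * ‖y‖ₑ ^ (-lam) ∂μ ≤ ∫⁻ y in S j, g y * k ∂μ := by
          refine setLIntegral_mono' (hSm j) fun y hy => ?_
          gcongr
          refine ENNReal.rpow_neg_le_rpow_neg ?_ hlam.le
          rw [← ofReal_norm]
          exact ENNReal.ofReal_le_ofReal hy.1
      _ = (∫⁻ y in S j, g y ∂μ) * k := lintegral_mul_const' _ _ hktop
      _ ≤ (∫⁻ y in ball 0 (σ / 2 ^ j), g y ∂μ) * k := by
          gcongr
          intro y hy
          rw [mem_ball_zero_iff]; exact hy.2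
      _ ≤ ((1 + j) * A * μ (ball (0 : E) (σ / 2 ^ j))) * k := by gcongr; exact hg j
      _ = _ := by
          have h1 : μ (ball (0 : E) (σ / 2 ^ j)) =
              ENNReal.ofReal ((1 / 2 ^ j) ^ d) * μ (ball (0 : E) σ) := by
            rw [← measure_ball_mul_left 0 0 (by positivity)]; congr 2; ring
          have h2 : ENNReal.ofReal ((1 / 2 ^ j) ^ d) * k = ENNReal.ofReal (2 ^ lam) *
              ENNReal.ofReal q ^ j * ENNReal.ofReal σ ^ (-lam) := by
            rw [hk, ENNReal.ofReal_rpow_of_pos hσj, ENNReal.ofReal_rpow_of_pos hσ,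
              ← ENNReal.ofReal_pow (by positivity), ← ENNReal.ofReal_mul (by positivity),
              ← ENNReal.ofReal_mul (by positivity), ← ENNReal.ofReal_mul (by positivity)]
            congr 1
            rw [Real.div_rpow hσ.le (by positivity), hq, ← Real.rpow_natCast (1 / 2 ^ j) d,
              one_div, Real.inv_rpow (by positivity), ← Real.rpow_natCast 2 j,
              ← Real.rpow_natCast 2 (j + 1), ← Real.rpow_mul zero_le_two,
              ← Real.rpow_mul zero_le_two, ← Real.rpow_natCast _ j, ← Real.rpow_mul zero_le_two,
              div_eq_mul_inv, ← Real.rpow_neg zero_le_two, ← Real.rpow_neg zero_le_two,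
              mul_left_comm, ← Real.rpow_add two_pos, ← Real.rpow_add two_pos,
              mul_comm]
            congr 2
            push_cast
            ring
          rw [h1]
          calc (1 + (j : ℝ≥0∞)) * A * (ENNReal.ofReal ((1 / 2 ^ j) ^ d) * μ (ball (0 : E) σ)) * k
              = (1 + (j : ℝ≥0∞)) * A * μ (ball (0 : E) σ) *
                (ENNReal.ofReal ((1 / 2 ^ j) ^ d) * k) := by ring
            _ = _ := by rw [h2]; ring
  calc ∫⁻ y in ball 0 σ, g y * ‖y‖ₑ ^ (-lam) ∂μ
      ≤ ∫⁻ y in {0} ∪ ⋃ j, S j, g y * ‖y‖ₑ ^ (-lam) ∂μ := lintegral_mono_set hcov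
    _ ≤ ∫⁻ y in {0}, g y * ‖y‖ₑ ^ (-lam) ∂μ + ∫⁻ y in ⋃ j, S j, g y * ‖y‖ₑ ^ (-lam) ∂μ :=
        lintegral_union_le _ _ _
    _ = ∫⁻ y in ⋃ j, S j, g y * ‖y‖ₑ ^ (-lam) ∂μ := by
        rw [setLIntegral_measure_zero _ _ (measure_singleton 0), zero_add]
    _ ≤ ∑' j, ∫⁻ y in S j, g y * ‖y‖ₑ ^ (-lam) ∂μ := lintegral_iUnion_le _ _
    _ ≤ _ := ENNReal.tsum_le_tsum hterm
    _ = _ := by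
        rw [ENNReal.tsum_mul_right, ENNReal.tsum_mul_left]
        simp only [mul_assoc]

/-- The same for balls with an arbitrary centre `x ≠ 0`. -/
lemma exists_lintegral_ball_mul_enorm_rpow_le (μ : Measure E) [μ.IsAddHaarMeasure] [Nontrivial E]
    {lam : ℝ} (hlam : 0 < lam) (hlamn : lam < finrank ℝ E) :
    ∃ K : ℝ≥0∞, K ≠ ∞ ∧ ∀ (g : E → ℝ≥0∞) (A : ℝ≥0∞) (x : E) (ρ : ℝ), ‖x‖ < ρ → ρ ≤ 2 * ‖x‖ →
      (∀ s, 0 < s → s ≤ ‖x‖ / 2 → ∫⁻ y in ball x s, g y ∂μ ≤ A * μ (ball x s)) →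
      (∀ m j : ℕ, ∫⁻ y in ball 0 (2 ^ m * (3 * ρ) / 2 ^ j), g y ∂μ ≤
        (1 + j) * ((1 + m) * A) * μ (ball (0 : E) (2 ^ m * (3 * ρ) / 2 ^ j))) →
      ∀ s, 0 < s → ∫⁻ y in ball x s, g y * ‖y‖ₑ ^ (-lam) ∂μ ≤
        K * A * ‖x‖ₑ ^ (-lam) * μ (ball x s) := by
  obtain ⟨K₀, hK₀, hK⟩ := exists_lintegral_mul_enorm_rpow_le μ hlam hlamn
  set d := finrank ℝ E with hd
  set q : ℝ := 2 ^ (-lam) with hq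
  have hq1 : ENNReal.ofReal q < 1 := by
    rw [ENNReal.ofReal_lt_one]
    exact Real.rpow_lt_one_of_one_lt_of_neg one_lt_two (by linarith)
  set Z := ∑' j : ℕ, (1 + (j : ℝ≥0∞)) * ENNReal.ofReal q ^ j with hZ
  refine ⟨ENNReal.ofReal (2 ^ lam) + K₀ * Z * ENNReal.ofReal (12 ^ d),
    ENNReal.add_ne_top.2 ⟨ENNReal.ofReal_ne_top, ENNReal.mul_ne_top (ENNReal.mul_ne_top hK₀
      (ENNReal.tsum_one_add_mul_pow_ne_top hq1)) ENNReal.ofReal_ne_top⟩, ?_⟩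
  intro g A x ρ hxρ hρx hnear hfar s hs
  have hx0 : 0 < ‖x‖ := by linarith [norm_nonneg x]
  have hρ : 0 < ρ := hx0.trans hxρ
  have hwx : ‖x‖ₑ ^ (-lam) = ENNReal.ofReal (‖x‖ ^ (-lam)) := by
    rw [← ofReal_norm, ENNReal.ofReal_rpow_of_pos hx0]
  rw [add_mul, add_mul, add_mul]
  -- On a small ball the weight is at most `2 ^ lam * |x| ^ (-lam)`. A large ball lies in a centred
  -- ball of comparable volume.
  rcases le_or_gt s (‖x‖ / 2) with hsx | hsx
  · refine le_add_right ?_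
    set k := ENNReal.ofReal (‖x‖ / 2) ^ (-lam) with hk
    have hk' : k = ENNReal.ofReal (2 ^ lam) * ‖x‖ₑ ^ (-lam) := by
      rw [hk, hwx, ENNReal.ofReal_rpow_of_pos (by positivity), ← ENNReal.ofReal_mul (by positivity),
        Real.div_rpow hx0.le zero_le_two, Real.rpow_neg zero_le_two, div_inv_eq_mul, mul_comm]
    have hktop : k ≠ ∞ := by
      rw [hk, ENNReal.ofReal_rpow_of_pos (by positivity)]; exact ENNReal.ofReal_ne_top
    calc ∫⁻ y in ball x s, g y * ‖y‖ₑ ^ (-lam) ∂μ ≤ ∫⁻ y in ball x s, g y * k ∂μ := by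
          refine setLIntegral_mono' measurableSet_ball fun y hy => ?_
          gcongr
          refine ENNReal.rpow_neg_le_rpow_neg ?_ hlam.le
          rw [← ofReal_norm]
          refine ENNReal.ofReal_le_ofReal ?_
          rw [mem_ball, dist_eq_norm] at hy
          have := norm_sub_norm_le x y
          rw [norm_sub_rev] at this
          linarith
      _ = (∫⁻ y in ball x s, g y ∂μ) * k := lintegral_mul_const' _ _ hktop
      _ ≤ (A * μ (ball x s)) * k := by gcongr; exact hnear s hs hsx
      _ = _ := by rw [hk']; ring
  · refine le_add_left ?_
    -- For `s ≤ ρ` one has `ρ ≤ 2‖x‖ < 4s`, so `m = 0` serves. In all cases `B(x, s)` lies in the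
    -- centred ball of radius `3 * 2 ^ m * ρ ≤ 12 s`.
    obtain ⟨m, hm1, hm2⟩ : ∃ m : ℕ, s ≤ 2 ^ m * ρ ∧ 2 ^ m * ρ ≤ 4 * s := by
      rcases le_or_gt s ρ with h | h
      · exact ⟨0, by simpa using h, by simp; linarith⟩
      · obtain ⟨j, hj1, hj2⟩ := exists_nat_pow_near (show (1 : ℝ) ≤ s / ρ by
          rw [le_div_iff₀ hρ]; linarith) one_lt_two
        rw [le_div_iff₀ hρ] at hj1
        rw [div_lt_iff₀ hρ] at hj2
        exact ⟨j + 1, hj2.le, by rw [pow_succ]; linarith⟩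
    set σ := 2 ^ m * (3 * ρ) with hσ
    have hσ0 : 0 < σ := by positivity
    have hsub : ball x s ⊆ ball 0 σ := by
      intro y hy
      rw [mem_ball, dist_eq_norm] at hy
      rw [mem_ball_zero_iff]
      have := norm_le_norm_add_norm_sub' y x
      linarith
    have hvol : μ (ball (0 : E) σ) ≤ ENNReal.ofReal (12 ^ d) * μ (ball x s) := by
      rw [← measure_ball_mul_left 0 x (by norm_num)]
      exact measure_mono (ball_subset_ball (by linarith))
    -- The decay of `σ ^ (-lam)` in `m` absorbs the growth `1 + m`.
    have hpow : (1 + (m : ℝ≥0∞)) * ENNReal.ofReal σ ^ (-lam) ≤ Z * ‖x‖ₑ ^ (-lam) := by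
      have h1 : ENNReal.ofReal σ ^ (-lam) ≤ ENNReal.ofReal q ^ m * ‖x‖ₑ ^ (-lam) := by
        rw [hwx, ENNReal.ofReal_rpow_of_pos hσ0, ← ENNReal.ofReal_pow (by positivity),
          ← ENNReal.ofReal_mul (by positivity)]
        refine ENNReal.ofReal_le_ofReal ?_
        rw [hσ, Real.mul_rpow (by positivity) (by positivity), hq]
        have : ((2 : ℝ) ^ m) ^ (-lam) = (2 ^ (-lam)) ^ m := by
          rw [← Real.rpow_natCast, ← Real.rpow_natCast, ← Real.rpow_mul zero_le_two,
            ← Real.rpow_mul zero_le_two, mul_comm]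
        rw [this]
        exact mul_le_mul_of_nonneg_left
          (Real.rpow_le_rpow_of_nonpos hx0 (by linarith) (by linarith)) (by positivity)
      calc (1 + (m : ℝ≥0∞)) * ENNReal.ofReal σ ^ (-lam)
          ≤ (1 + (m : ℝ≥0∞)) * (ENNReal.ofReal q ^ m * ‖x‖ₑ ^ (-lam)) := by gcongr
        _ = ((1 + (m : ℝ≥0∞)) * ENNReal.ofReal q ^ m) * ‖x‖ₑ ^ (-lam) := by ring
        _ ≤ _ := by
          gcongr
          exact ENNReal.le_tsum (f := fun j : ℕ => (1 + (j : ℝ≥0∞)) * ENNReal.ofReal q ^ j) m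
    calc ∫⁻ y in ball x s, g y * ‖y‖ₑ ^ (-lam) ∂μ
        ≤ ∫⁻ y in ball 0 σ, g y * ‖y‖ₑ ^ (-lam) ∂μ := lintegral_mono_set hsub
      _ ≤ K₀ * ((1 + m) * A) * ENNReal.ofReal σ ^ (-lam) * μ (ball (0 : E) σ) :=
          hK g _ σ hσ0 (hfar m)
      _ = K₀ * A * ((1 + m) * ENNReal.ofReal σ ^ (-lam)) * μ (ball (0 : E) σ) := by ring
      _ ≤ K₀ * A * (Z * ‖x‖ₑ ^ (-lam)) * (ENNReal.ofReal (12 ^ d) * μ (ball x s)) := by gcongr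
      _ = _ := by ring

end PowerWeight

/-! ### Weighted oscillation at a fixed point. -/

section Pointwise

variable {E : Type*} [NormedAddCommGroup E] [NormedSpace ℝ E] [FiniteDimensional ℝ E]
  [MeasurableSpace E] [BorelSpace E]

/-- Lebesgue points. Arbitrarily small good radii suffice to compare `β x` with the constant of a
ball. -/
lemma ae_frequently_lintegral_enorm_sub_le {μ : Measure E} [μ.IsAddHaarMeasure] {β : E → ℝ}
    (hβ : LocallyIntegrable β μ) :
    ∀ᵐ x ∂μ, ∀ ε : ℝ≥0∞, ε ≠ 0 → ∀ r₀ : ℝ, 0 < r₀ → ∃ r, 0 < r ∧ r ≤ r₀ ∧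
      ∫⁻ y in ball x r, ‖β y - β x‖ₑ ∂μ ≤ ε * μ (ball x r) := by
  filter_upwards [(IsUnifLocDoublingMeasure.vitaliFamily μ 1).ae_tendsto_lintegral_enorm_sub_div
    hβ] with x hx ε hε r₀ hr₀
  have hlim := hx.comp (IsUnifLocDoublingMeasure.tendsto_closedBall_filterAt μ (K := 1)
    (fun _ : ℝ => x) (fun r : ℝ => r) (l := 𝓝[>] 0) tendsto_id (by
      filter_upwards [self_mem_nhdsWithin] with r hr
      have : (0 : ℝ) < r := hr
      simp [this.le]))
  have h1 := (hlim.eventually_lt_const (pos_iff_ne_zero.2 hε)).and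
    (Ioc_mem_nhdsGT hr₀)
  obtain ⟨r, hr, hr0, hrr⟩ := h1.exists
  refine ⟨r, hr0, hrr, ?_⟩
  have h2 := (ENNReal.div_le_iff_le_mul
    (Or.inl (measure_closedBall_pos μ x hr0).ne') (Or.inl measure_closedBall_lt_top.ne)).1 hr.le
  rw [Measure.addHaar_closedBall μ x hr0.le, ← Measure.addHaar_ball_of_pos μ x hr0] at h2
  exact (lintegral_mono_set ball_subset_closedBall).trans h2

variable {μ : Measure E} [μ.IsAddHaarMeasure] {β : E → ℝ} {c : E → ℝ → ℝ} {D : ℝ≥0∞}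

/-- Constants of concentric balls of ratio 2 are compared on the smaller ball, and the differences
telescope. -/
lemma HasMeanOscillation.enorm_sub_le (h : HasMeanOscillation μ β c D) (hβ : AEMeasurable β μ)
    (a : E) {σ : ℝ} (hσ : 0 < σ) (m : ℕ) :
    ‖c a (2 ^ m * σ) - c a σ‖ₑ ≤ m * ((ENNReal.ofReal (2 ^ finrank ℝ E) + 1) * D) := by
  induction m with
  | zero => simp
  | succ m ih =>
    set ρ := 2 ^ m * σ with hρ
    have hρ0 : 0 < ρ := by positivity
    have e : 2 ^ (m + 1) * σ = 2 * ρ := by rw [hρ]; ring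
    rw [e]
    have h1 : ‖c a (2 * ρ) - c a ρ‖ₑ ≤ (ENNReal.ofReal (2 ^ finrank ℝ E) + 1) * D := by
      have h2 := enorm_sub_mul_measure_le hβ (ball a ρ) (c a (2 * ρ)) (c a ρ)
      have h3 : ∫⁻ y in ball a ρ, ‖β y - c a (2 * ρ)‖ₑ ∂μ ≤
          D * (ENNReal.ofReal (2 ^ finrank ℝ E) * μ (ball a ρ)) := by
        rw [← measure_ball_mul_left a a two_pos]
        exact (lintegral_mono_set (ball_subset_ball (by linarith))).trans (h a _ (by linarith))
      have h4 := h2.trans (add_le_add h3 (h a ρ hρ0))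
      have h5 : ‖c a (2 * ρ) - c a ρ‖ₑ * μ (ball a ρ) ≤
          ((ENNReal.ofReal (2 ^ finrank ℝ E) + 1) * D) * μ (ball a ρ) :=
        h4.trans (le_of_eq (by ring))
      exact (ENNReal.mul_le_mul_iff_left (measure_ball_pos _ _ hρ0).ne'
        measure_ball_lt_top.ne).1 h5
    have e2 : c a (2 * ρ) - c a σ = (c a (2 * ρ) - c a ρ) + (c a ρ - c a σ) := by ring
    rw [e2]
    refine (enorm_add_le _ _).trans ((add_le_add h1 ih).trans (le_of_eq ?_))
    push_cast
    ring

/-- Off the exceptional set, balls centred at `x` of radius at most `ρ` have mean oscillation at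
most `τ * D` about `c₀`. Letting the radius shrink at a Lebesgue point gives `|c₀ - β x| ≤ τ * D`.
For centred balls of other sizes the constant drifts only linearly in the number of scales, which
the power weight tolerates. -/
lemma exists_lintegral_enorm_sub_mul_rpow_le (μ : Measure E) [μ.IsAddHaarMeasure] [Nontrivial E]
    {lam : ℝ} (hlam : 0 < lam) (hlamn : lam < finrank ℝ E) :
    ∃ K : ℝ≥0∞, K ≠ ∞ ∧ ∀ (β : E → ℝ) (c : E → ℝ → ℝ) (D : ℝ≥0∞), AEMeasurable β μ →
      HasMeanOscillation μ β c D → ∀ (x : E) (ρ : ℝ) (τ : ℝ≥0∞), ‖x‖ < ρ → ρ ≤ 2 * ‖x‖ →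
      (∀ ε : ℝ≥0∞, ε ≠ 0 → ∀ r₀ : ℝ, 0 < r₀ → ∃ r, 0 < r ∧ r ≤ r₀ ∧
        ∫⁻ y in ball x r, ‖β y - β x‖ₑ ∂μ ≤ ε * μ (ball x r)) →
      x ∉ largeOscillationSet μ β c D 0 ρ τ →
      ∀ s, 0 < s → ∫⁻ y in ball x s, ‖β y - β x‖ₑ * ‖y‖ₑ ^ (-lam) ∂μ ≤
        K * ((τ + 1) * D) * ‖x‖ₑ ^ (-lam) * μ (ball x s) := by
  obtain ⟨K₀, hK₀, hK⟩ := exists_lintegral_ball_mul_enorm_rpow_le μ hlam hlamn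
  set L : ℝ≥0∞ := ENNReal.ofReal (2 ^ finrank ℝ E) + 1 with hL
  have hL1 : 1 ≤ L := le_add_self
  have hLtop : L ≠ ∞ := ENNReal.add_ne_top.2 ⟨ENNReal.ofReal_ne_top, ENNReal.one_ne_top⟩
  refine ⟨K₀ * (2 * L), ENNReal.mul_ne_top hK₀ (ENNReal.mul_ne_top (by norm_num) hLtop), ?_⟩
  intro β c D hβ h x ρ τ hxρ hρx hleb hx s hs
  have hρ : 0 < ρ := (norm_nonneg x).trans_lt hxρ
  set c₀ := c 0 (3 * ρ) with hc₀
  have hosc : ∀ r, 0 < r → r ≤ ρ →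
      ∫⁻ y in ball x r, ‖β y - c₀‖ₑ ∂μ ≤ τ * D * μ (ball x r) := by
    intro r hr hrρ
    by_contra! hcon
    exact hx ⟨by simpa using hxρ, x, r, hr, hrρ, mem_ball_self hr, hcon⟩
  have hval : ‖c₀ - β x‖ₑ ≤ τ * D := by
    refine ENNReal.le_of_forall_pos_le_add fun ε hε _ => ?_
    obtain ⟨r, hr0, hrρ, hr⟩ := hleb ε (by exact_mod_cast hε.ne') ρ hρ
    have h1 := (enorm_sub_mul_measure_le hβ (ball x r) c₀ (β x)).trans
      (add_le_add (hosc r hr0 hrρ) hr)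
    rw [← add_mul] at h1
    exact (ENNReal.mul_le_mul_iff_left (measure_ball_pos _ _ hr0).ne'
        measure_ball_lt_top.ne).1 h1
  have hfin := hK (fun y => ‖β y - β x‖ₑ) ((2 * L) * ((τ + 1) * D)) x ρ hxρ hρx ?_ ?_ s hs
  · exact hfin.trans (le_of_eq (by ring))
  · intro r hr hrx
    calc ∫⁻ y in ball x r, ‖β y - β x‖ₑ ∂μ
        ≤ ∫⁻ y in ball x r, ‖β y - c₀‖ₑ ∂μ + ‖c₀ - β x‖ₑ * μ (ball x r) :=
          lintegral_enorm_sub_le_add β _ _ _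
      _ ≤ τ * D * μ (ball x r) + τ * D * μ (ball x r) := by
          gcongr
          exact hosc r hr (by linarith [norm_nonneg x])
      _ = (2 * 1) * (τ * D) * μ (ball x r) := by ring
      _ ≤ (2 * L) * ((τ + 1) * D) * μ (ball x r) := by
          gcongr
          exact le_self_add
  · intro m j
    set σ := 2 ^ m * (3 * ρ) with hσ
    have hσ0 : 0 < σ := by positivity
    have h1 : ‖c 0 (σ / 2 ^ j) - β x‖ₑ ≤ j * (L * D) + (m * (L * D) + τ * D) := by
      have e : c 0 (σ / 2 ^ j) - β x = (c 0 (σ / 2 ^ j) - c 0 σ) + ((c 0 σ - c₀) + (c₀ - β x)) := by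
        ring
      rw [e]
      refine (enorm_add_le _ _).trans (add_le_add ?_ ((enorm_add_le _ _).trans
        (add_le_add (h.enorm_sub_le hβ 0 (by positivity) m) hval)))
      rw [enorm_sub_rev]
      have := h.enorm_sub_le hβ 0 (show 0 < σ / 2 ^ j by positivity) j
      rwa [mul_div_cancel₀ _ (by positivity)] at this
    calc ∫⁻ y in ball 0 (σ / 2 ^ j), ‖β y - β x‖ₑ ∂μ
        ≤ ∫⁻ y in ball 0 (σ / 2 ^ j), ‖β y - c 0 (σ / 2 ^ j)‖ₑ ∂μ +
          ‖c 0 (σ / 2 ^ j) - β x‖ₑ * μ (ball (0 : E) (σ / 2 ^ j)) :=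
          lintegral_enorm_sub_le_add β _ _ _
      _ ≤ D * μ (ball (0 : E) (σ / 2 ^ j)) +
          (j * (L * D) + (m * (L * D) + τ * D)) * μ (ball (0 : E) (σ / 2 ^ j)) := by
          gcongr
          exact h 0 _ (by positivity)
      _ = (1 * D + (j * (L * D) + (m * (L * D) + τ * (1 * D)))) * μ (ball (0 : E) (σ / 2 ^ j)) := by
          ring
      _ ≤ (L * D + (j * (L * D) + (m * (L * D) + τ * (L * D)))) *
          μ (ball (0 : E) (σ / 2 ^ j)) := by gcongr
      -- The added term supplies the monomials missing from `2 * (1 + j) * (1 + m) * (τ + 1)`.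
      _ ≤ (L * D + (j * (L * D) + (m * (L * D) + τ * (L * D)))) * μ (ball (0 : E) (σ / 2 ^ j)) +
          (L * D) * (1 + 2 * τ * m + j + m + 2 * j * m + 2 * j * m * τ + 2 * j * τ + τ) *
            μ (ball (0 : E) (σ / 2 ^ j)) := le_self_add
      _ = (1 + j) * ((1 + m) * (2 * L * ((τ + 1) * D))) * μ (ball (0 : E) (σ / 2 ^ j)) := by ring

/-- The power weight is an `A₁` weight: this is the case of density `1`. -/
lemma exists_lintegral_rpow_le (μ : Measure E) [μ.IsAddHaarMeasure] [Nontrivial E]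
    {lam : ℝ} (hlam : 0 < lam) (hlamn : lam < finrank ℝ E) :
    ∃ K : ℝ≥0∞, K ≠ ∞ ∧ ∀ x : E, x ≠ 0 → ∀ s, 0 < s →
      ∫⁻ y in ball x s, ‖y‖ₑ ^ (-lam) ∂μ ≤ K * ‖x‖ₑ ^ (-lam) * μ (ball x s) := by
  obtain ⟨K, hK₀, hK⟩ := exists_lintegral_ball_mul_enorm_rpow_le μ hlam hlamn
  refine ⟨K, hK₀, fun x hx s hs => ?_⟩
  have hx' := norm_pos_iff.2 hx
  simpa using hK (fun _ => 1) 1 x (2 * ‖x‖) (by linarith) le_rfl (by simp)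
    (fun m j => by
      simp only [lintegral_one, MeasurableSet.univ, Measure.restrict_apply, univ_inter]
      refine le_mul_of_one_le_left' ?_
      rw [mul_one]
      exact one_le_mul le_self_add le_self_add) s hs

end Pointwise

/-! ### From exceptional sets to a weak-type bound. -/

section WeakType

variable {E : Type*} [NormedAddCommGroup E] [NormedSpace ℝ E] [FiniteDimensional ℝ E]
  [MeasurableSpace E] [BorelSpace E]

/-- A function that is dominated by `(τ + 1) |x|^(-lam)` off the sets of large oscillation at level
`τ` lies in weak `L^(d / lam)`. -/
lemma exists_measure_lt_le_of_forall_notMem (μ : Measure E) [μ.IsAddHaarMeasure] [Nontrivial E]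
    {lam : ℝ} (hlam : 0 < lam) :
    ∃ K : ℝ, 0 < K ∧ ∀ (β : E → ℝ) (c : E → ℝ → ℝ) (D : ℝ≥0∞), AEMeasurable β μ →
      HasMeanOscillation μ β c D → D ≠ 0 → D ≠ ∞ → ∀ (h : E → ℝ≥0∞) (M : ℝ), 0 < M →
      (∀ᵐ x ∂μ, ∀ ρ τ : ℝ, 0 < τ → ‖x‖ < ρ → ρ ≤ 2 * ‖x‖ →
        x ∉ largeOscillationSet μ β c D 0 ρ (ENNReal.ofReal τ) →
        h x ≤ ENNReal.ofReal (M * (τ + 1)) * ‖x‖ₑ ^ (-lam)) →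
      ∀ t : ℝ, 0 < t →
        μ {x | ENNReal.ofReal t < h x} ≤ ENNReal.ofReal ((K * M / t) ^ (finrank ℝ E / lam)) := by
  set d := finrank ℝ E with hd
  have hd0 : (0 : ℝ) < d := by exact_mod_cast finrank_pos
  -- With `lam * s ≥ d + 1` the tail at level `2 ^ (lam j)` beats the volume `2 ^ (d j)` with `2 ^
  -- (-j)` to spare.
  obtain ⟨s, hs⟩ := exists_nat_ge ((d + 1) / lam)
  rw [div_le_iff₀ hlam] at hs
  obtain ⟨K₀, hK₀, hK⟩ := exists_measure_largeOscillationSet_le_div_pow μ s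
  set κ := (μ (ball (0 : E) 1)).toReal with hκ
  have hκe : μ (ball (0 : E) 1) = ENNReal.ofReal κ :=
    (ENNReal.ofReal_toReal measure_ball_lt_top.ne).symm
  have hκ0 : 0 < κ := ENNReal.toReal_pos (measure_ball_pos _ _ one_pos).ne' measure_ball_lt_top.ne
  set C := κ * (1 + 2 * 2 ^ d * K₀) with hC
  have hC0 : 0 < C := by positivity
  set p := (d : ℝ) / lam with hp
  have hp0 : 0 < p := by positivity
  refine ⟨2 * C ^ p⁻¹, by positivity, ?_⟩
  intro β c D hβ hosc hD0 hD h M hM hae t ht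
  -- The radius at which `2 * M * ρ₀ ^ (-lam) = t`. The 2 comes from `τ + 1 ≤ 2τ` for the levels `τ
  -- ≥ 1` used below.
  set ρ₀ := (2 * M / t) ^ lam⁻¹ with hρ₀
  have hρ₀0 : 0 < ρ₀ := by positivity
  have hρlam : ρ₀ ^ (-lam) = t / (2 * M) := by
    rw [hρ₀, ← Real.rpow_mul (by positivity), mul_neg, inv_mul_cancel₀ hlam.ne',
      Real.rpow_neg_one, inv_div]
  have hρd : ρ₀ ^ d = (2 * M / t) ^ p := by
    rw [hρ₀, ← Real.rpow_natCast, ← Real.rpow_mul (by positivity), hp]; congr 1; ring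
  let N : Set E := {x | ¬ ∀ ρ τ : ℝ, 0 < τ → ‖x‖ < ρ → ρ ≤ 2 * ‖x‖ →
        x ∉ largeOscillationSet μ β c D 0 ρ (ENNReal.ofReal τ) →
        h x ≤ ENNReal.ofReal (M * (τ + 1)) * ‖x‖ₑ ^ (-lam)}
  have hN : μ N = 0 := hae
  let V : ℕ → Set E := fun j =>
    largeOscillationSet μ β c D 0 (2 ^ (j + 1) * ρ₀) (ENNReal.ofReal ((2 ^ lam) ^ j))
  have hcov : {x | ENNReal.ofReal t < h x} ⊆ N ∪ (ball 0 ρ₀ ∪ ⋃ j, V j) := by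
    intro x hx
    by_contra hcon
    simp only [mem_union, not_or, mem_iUnion, not_exists] at hcon
    obtain ⟨h1, h2, h3⟩ := hcon
    simp only [N, mem_ofPred_eq, not_not] at h1
    rw [mem_ball_zero_iff, not_lt] at h2
    obtain ⟨j, hj1, hj2⟩ := exists_nat_pow_near (show (1 : ℝ) ≤ ‖x‖ / ρ₀ by
      rw [le_div_iff₀ hρ₀0]; linarith) one_lt_two
    rw [le_div_iff₀ hρ₀0] at hj1
    rw [div_lt_iff₀ hρ₀0] at hj2
    have hx0 : 0 < ‖x‖ := hρ₀0.trans_le h2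
    have hq0 : (0 : ℝ) < (2 ^ lam) ^ j := by positivity
    have hq1 : (1 : ℝ) ≤ (2 ^ lam) ^ j := one_le_pow₀ (Real.one_le_rpow one_le_two hlam.le)
    have h4 := h1 (2 ^ (j + 1) * ρ₀) ((2 ^ lam) ^ j) hq0 hj2 (by rw [pow_succ]; linarith) (h3 j)
    refine absurd hx (not_lt.2 (h4.trans ?_))
    rw [← ofReal_norm, ENNReal.ofReal_rpow_of_pos hx0, ← ENNReal.ofReal_mul (by positivity)]
    refine ENNReal.ofReal_le_ofReal ?_
    have h5 : ‖x‖ ^ (-lam) ≤ ((2 ^ lam) ^ j)⁻¹ * (t / (2 * M)) := by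
      calc ‖x‖ ^ (-lam) ≤ (2 ^ j * ρ₀) ^ (-lam) :=
            Real.rpow_le_rpow_of_nonpos (by positivity) hj1 (by linarith)
        _ = _ := by
          rw [Real.mul_rpow (by positivity) hρ₀0.le, hρlam, Real.rpow_neg (by positivity),
            ← Real.rpow_natCast, ← Real.rpow_natCast, ← Real.rpow_mul zero_le_two,
            ← Real.rpow_mul zero_le_two, mul_comm lam]
    calc M * ((2 ^ lam) ^ j + 1) * ‖x‖ ^ (-lam)
        ≤ M * ((2 ^ lam) ^ j + (2 ^ lam) ^ j) * (((2 ^ lam) ^ j)⁻¹ * (t / (2 * M))) := by gcongr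
      _ = t := by field_simp; ring
  have hV : ∀ j, μ (V j) ≤ ENNReal.ofReal (K₀ * 2 ^ d * ρ₀ ^ d * κ * (1 / 2) ^ j) := by
    intro j
    refine (hK β c D hβ hosc hD0 hD 0 (2 ^ (j + 1) * ρ₀) (by positivity) ((2 ^ lam) ^ j)
      (by positivity)).trans ?_
    rw [Measure.addHaar_ball_of_pos μ 0 (by positivity), hκe, ← ENNReal.ofReal_mul (by positivity),
      ← ENNReal.ofReal_mul (by positivity)]
    refine ENNReal.ofReal_le_ofReal ?_
    have h1 : (2 : ℝ) ^ (d + 1) ≤ (2 ^ lam) ^ s := by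
      rw [← Real.rpow_natCast, ← Real.rpow_natCast, ← Real.rpow_mul zero_le_two]
      refine Real.rpow_le_rpow_of_exponent_le one_le_two ?_
      push_cast
      linarith
    have h2 : ((2 : ℝ) ^ j) ^ d * 2 ^ j ≤ ((2 ^ lam) ^ j) ^ s := by
      calc ((2 : ℝ) ^ j) ^ d * 2 ^ j = (2 ^ (d + 1)) ^ j := by ring
        _ ≤ ((2 ^ lam) ^ s) ^ j := by gcongr
        _ = _ := by rw [← pow_mul, ← pow_mul, mul_comm]
    rw [← hd, div_mul_eq_mul_div, div_le_iff₀ (by positivity)]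
    calc K₀ * ((2 ^ (j + 1) * ρ₀) ^ d * κ)
        = K₀ * 2 ^ d * ρ₀ ^ d * κ * (1 / 2) ^ j * (((2 : ℝ) ^ j) ^ d * 2 ^ j) := by
          rw [mul_pow, pow_succ, mul_pow, one_div, inv_pow]; field_simp
      _ ≤ _ := by gcongr
  calc μ {x | ENNReal.ofReal t < h x}
      ≤ μ N + (μ (ball 0 ρ₀) + ∑' j, μ (V j)) := (measure_mono hcov).trans
        ((measure_union_le _ _).trans (add_le_add le_rfl ((measure_union_le _ _).trans
          (add_le_add le_rfl (measure_iUnion_le _)))))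
    _ ≤ 0 + (ENNReal.ofReal (ρ₀ ^ d * κ) +
        ∑' j : ℕ, ENNReal.ofReal (K₀ * 2 ^ d * ρ₀ ^ d * κ * (1 / 2) ^ j)) := by
        refine add_le_add hN.le (add_le_add ?_ (ENNReal.tsum_le_tsum hV))
        rw [Measure.addHaar_ball_of_pos μ 0 hρ₀0, hκe, ← ENNReal.ofReal_mul (by positivity)]
    _ = ENNReal.ofReal (ρ₀ ^ d * κ + K₀ * 2 ^ d * ρ₀ ^ d * κ * 2) := by
        rw [zero_add, ENNReal.ofReal_add (by positivity) (by positivity),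
          ← ENNReal.ofReal_tsum_of_nonneg (fun j => by positivity)
            (summable_geometric_two.mul_left _), tsum_mul_left, tsum_geometric_two]
    _ = ENNReal.ofReal ((2 * C ^ p⁻¹ * M / t) ^ p) := by
        congr 1
        have : 2 * C ^ p⁻¹ * M / t = (2 * M / t) * C ^ p⁻¹ := by ring
        rw [this, Real.mul_rpow (by positivity) (by positivity), ← Real.rpow_mul hC0.le,
          inv_mul_cancel₀ hp0.ne', Real.rpow_one, hρd, hC]
        ring

end WeakType

/-! ### Comparison of cubes and balls. -/

section Cubes

variable {n : ℕ}

lemma isOpen_axisCube (a : EuclideanSpace ℝ (Fin n)) (r : ℝ) : IsOpen (axisCube a r) := by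
  simp only [axisCube, ofPred_forall]
  exact isOpen_iInter_of_finite fun i => isOpen_lt (by fun_prop) continuous_const

lemma volume_axisCube (a : EuclideanSpace ℝ (Fin n)) {r : ℝ} (hr : 0 < r) :
    volume (axisCube a r) = ENNReal.ofReal ((2 * r) ^ n) := by
  have h := (EuclideanSpace.volume_preserving_symm_measurableEquiv_toLp
    (Fin n)).measure_preimage_equiv (univ.pi fun i => Ioo (a i - r) (a i + r))
  have e : axisCube a r = (MeasurableEquiv.toLp 2 (Fin n → ℝ)).symm ⁻¹'
      (univ.pi fun i => Ioo (a i - r) (a i + r)) := by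
    ext y
    simp only [axisCube, mem_ofPred_eq, mem_preimage, mem_univ_pi, mem_Ioo, abs_lt]
    refine forall_congr' fun i => ?_
    constructor
    · rintro ⟨h1, h2⟩; constructor <;> simp <;> linarith
    · rintro ⟨h1, h2⟩; simp at h1 h2; constructor <;> linarith
  rw [e, h, Real.volume_pi_Ioo]
  rw [ENNReal.ofReal_pow (by positivity), two_mul]
  simp

lemma ball_subset_axisCube (a : EuclideanSpace ℝ (Fin n)) (r : ℝ) : ball a r ⊆ axisCube a r := by
  intro y hy i
  rw [mem_ball, dist_eq_norm] at hy
  have := PiLp.norm_apply_le (y - a) i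
  simp only [PiLp.sub_apply, Real.norm_eq_abs] at this
  exact this.trans_lt hy

lemma EuclideanSpace.norm_lt_of_forall_abs_lt (hn : n ≠ 0) {v : EuclideanSpace ℝ (Fin n)} {r : ℝ}
    (h : ∀ i, |v i| < r) : ‖v‖ < n * r := by
  have hn1 : (1 : ℝ) ≤ n := by exact_mod_cast Nat.one_le_iff_ne_zero.2 hn
  have : Nonempty (Fin n) := ⟨⟨0, Nat.pos_of_ne_zero hn⟩⟩
  have hr : 0 < r := (abs_nonneg _).trans_lt (h (Classical.arbitrary _))
  rw [EuclideanSpace.norm_eq, Real.sqrt_lt' (by positivity)]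
  calc ∑ i, ‖v i‖ ^ 2 < ∑ _i : Fin n, r ^ 2 := by
        refine Finset.sum_lt_sum_of_nonempty Finset.univ_nonempty fun i _ => ?_
        rw [Real.norm_eq_abs]
        exact pow_lt_pow_left₀ (h i) (abs_nonneg _) two_ne_zero
    _ = n * r ^ 2 := by simp
    _ ≤ (n * r) ^ 2 := by
        rw [mul_pow]; gcongr; nlinarith

lemma axisCube_subset_ball (hn : n ≠ 0) {a x : EuclideanSpace ℝ (Fin n)} {r : ℝ}
    (hx : x ∈ axisCube a r) : axisCube a r ⊆ ball x (n * (2 * r)) := by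
  intro y hy
  rw [mem_ball, dist_eq_norm]
  refine EuclideanSpace.norm_lt_of_forall_abs_lt hn fun i => ?_
  have h1 := hx i
  have h2 := hy i
  simp only [PiLp.sub_apply]
  rw [abs_lt] at *
  constructor <;> linarith

lemma volume_axisCube_ne_zero (a : EuclideanSpace ℝ (Fin n)) {r : ℝ} (hr : 0 < r) :
    volume (axisCube a r) ≠ 0 := by
  rw [volume_axisCube a hr]; simpa using by positivity

lemma volume_axisCube_ne_top (a : EuclideanSpace ℝ (Fin n)) {r : ℝ} (hr : 0 < r) :
    volume (axisCube a r) ≠ ∞ := by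
  rw [volume_axisCube a hr]; exact ENNReal.ofReal_ne_top

/-- Means over cubes through `x` are controlled by means over balls centred at `x`. -/
lemma setLAverage_axisCube_le (hn : n ≠ 0) {g : EuclideanSpace ℝ (Fin n) → ℝ≥0∞}
    {x : EuclideanSpace ℝ (Fin n)} {A : ℝ≥0∞}
    (h : ∀ s, 0 < s → ∫⁻ y in ball x s, g y ≤ A * volume (ball x s))
    {a : EuclideanSpace ℝ (Fin n)} {r : ℝ} (hr : 0 < r) (hx : x ∈ axisCube a r) :
    ⨍⁻ y in axisCube a r, g y ∂volume ≤
      ENNReal.ofReal (n ^ n) * volume (ball (0 : EuclideanSpace ℝ (Fin n)) 1) * A := by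
  have hn0 : (0 : ℝ) < n := by exact_mod_cast Nat.pos_of_ne_zero hn
  rw [setLAverage_eq, ENNReal.div_le_iff (volume_axisCube_ne_zero a hr)
    (volume_axisCube_ne_top a hr)]
  refine (lintegral_mono_set (axisCube_subset_ball hn hx)).trans ((h _ (by positivity)).trans ?_)
  rw [Measure.addHaar_ball_of_pos _ x (by positivity), volume_axisCube a hr, mul_pow,
    ENNReal.ofReal_mul (by positivity), finrank_euclideanSpace_fin]
  exact le_of_eq (by ring)

end Cubes

/-! ### Absolute values in `[-∞,∞]`. -/

section EReal

lemma EReal.abs_eq_max (x : EReal) : x.abs = max x.toENNReal (-x).toENNReal := by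
  induction x with
  | bot => simp
  | top => simp
  | coe x =>
    rw [EReal.abs_def, ← EReal.coe_neg, EReal.toENNReal_of_ne_top (EReal.coe_ne_top _),
      EReal.toENNReal_of_ne_top (EReal.coe_ne_top _), EReal.toReal_coe, EReal.toReal_coe, abs,
      ENNReal.ofReal_max]

lemma EReal.abs_le_abs_of_nonneg {x y : EReal} (hx : 0 ≤ x) (h : x ≤ y) : x.abs ≤ y.abs := by
  rw [EReal.abs_eq_max, EReal.abs_eq_max, EReal.toENNReal_of_nonpos (x := -x) (by simpa using hx),
    max_eq_left zero_le]
  exact le_max_of_le_left (EReal.toENNReal_le_toENNReal h)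

lemma EReal.abs_le_abs_of_nonpos {x y : EReal} (hx : x ≤ 0) (h : y ≤ x) : x.abs ≤ y.abs := by
  rw [← EReal.abs_neg x, ← EReal.abs_neg y]
  exact EReal.abs_le_abs_of_nonneg (by simpa using hx) (EReal.neg_le_neg_iff.2 h)

lemma measurable_ereal_abs : Measurable EReal.abs := by
  rw [funext EReal.abs_eq_max]
  exact measurable_ereal_toENNReal.max
    (measurable_ereal_toENNReal.comp continuous_neg.measurable)

end EReal

/-! ### The Young function and its dyadic layers. -/

section Young

lemma le_zygmundYoung (t : ℝ≥0∞) : t ≤ zygmundYoung t := by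
  unfold zygmundYoung
  exact le_mul_of_one_le_right' le_self_add

lemma zygmundYoung_mono {s t : ℝ≥0∞} (h : s ≤ t) : zygmundYoung s ≤ zygmundYoung t := by
  unfold zygmundYoung
  gcongr
  exact EReal.toENNReal_le_toENNReal (ENNReal.log_le_log h)

lemma zygmundYoung_of_le_one {t : ℝ≥0∞} (h : t ≤ 1) : zygmundYoung t = t := by
  unfold zygmundYoung
  rw [EReal.toENNReal_of_nonpos (ENNReal.log_le_zero_iff.2 h), add_zero, mul_one]

lemma zygmundYoung_two_pow_le (j : ℕ) : zygmundYoung (2 ^ j) ≤ 2 ^ j * (1 + j) := by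
  unfold zygmundYoung
  gcongr
  have h2 : (2 : ℝ≥0∞) ^ j = ENNReal.ofReal (2 ^ j) := by
    rw [ENNReal.ofReal_pow zero_le_two]; simp
  rw [h2, ENNReal.log_ofReal_of_pos (by positivity), EReal.toENNReal_of_ne_top (EReal.coe_ne_top _),
    EReal.toReal_coe, ← ENNReal.ofReal_natCast, Real.log_pow]
  refine ENNReal.ofReal_le_ofReal (mul_le_of_le_one_right (Nat.cast_nonneg j) ?_)
  linarith [Real.log_two_lt_d9]

/-- Dyadic layers. -/
lemma zygmundYoung_le_add_tsum (t : ℝ≥0∞) :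
    zygmundYoung t ≤ 2⁻¹ + ∑' j : ℕ, if 2 ^ j / 2 < t then (2 : ℝ≥0∞) ^ j * (1 + j) else 0 := by
  rcases eq_or_ne t ∞ with rfl | ht
  · have h1 : ∑' j : ℕ, (if 2 ^ j / 2 < ∞ then (2 : ℝ≥0∞) ^ j * (1 + j) else 0) = ∞ := by
      refine top_le_iff.1 ((ENNReal.tsum_const_eq_top_of_ne_zero (α := ℕ)
        (one_ne_zero (α := ℝ≥0∞))).symm.le.trans (ENNReal.tsum_le_tsum fun j => ?_))
      rw [if_pos (ENNReal.div_lt_top (by finiteness) (by norm_num))]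
      exact one_le_mul (one_le_pow₀ (by norm_num)) le_self_add
    rw [h1]; simp
  · rcases le_or_gt t 2⁻¹ with h | h
    · rw [zygmundYoung_of_le_one (h.trans (by norm_num))]
      exact h.trans le_self_add
    · refine le_add_left ?_
      have hex : ∃ j : ℕ, t ≤ 2 ^ j := by
        obtain ⟨m, hm⟩ := ENNReal.exists_nat_gt ht
        exact ⟨m, hm.le.trans (by exact_mod_cast Nat.lt_two_pow_self.le)⟩
      classical
      -- The least such `j` has `2 ^ j / 2 < t` even for `j = 0`, because `t > 1/2` here.
      set j := Nat.find hex with hj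
      have h1 : t ≤ 2 ^ j := Nat.find_spec hex
      have h2 : 2 ^ j / 2 < t := by
        rcases Nat.eq_zero_or_pos j with h0 | h0
        · rw [h0]; simpa using h
        · have := Nat.find_min hex (m := j - 1) (by omega)
          rw [not_le] at this
          obtain ⟨i, hi⟩ := Nat.exists_eq_succ_of_ne_zero h0.ne'
          rw [hi] at this ⊢
          rw [pow_succ, ENNReal.mul_div_cancel_right (by norm_num) (by norm_num)]
          simpa using this
      refine (zygmundYoung_mono h1).trans ((zygmundYoung_two_pow_le j).trans ?_)
      refine le_trans (le_of_eq ?_) (ENNReal.le_tsum j)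
      rw [if_pos h2]

end Young

/-! ### Weak spaces and radially decreasing functions in the Zygmund–Morrey space. -/

section ZygmundMorrey

variable {n : ℕ}

lemma laverage_abs_le_zygmundAverage (g : EuclideanSpace ℝ (Fin n) → EReal)
    (Q : Set (EuclideanSpace ℝ (Fin n))) :
    ⨍⁻ x in Q, (g x).abs ∂volume ≤ zygmundAverage g Q := by
  refine le_sInf ?_
  rintro α ⟨hα0, hα, h⟩
  have h1 : ⨍⁻ x in Q, (g x).abs / α ∂volume ≤ 1 :=
    le_trans (by
      simp only [setLAverage_eq]
      gcongr
      exact le_zygmundYoung _) h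
  simp only [setLAverage_eq, div_eq_mul_inv] at h1 ⊢
  rw [lintegral_mul_const' _ _ (ENNReal.inv_ne_top.2 hα0.ne'), mul_right_comm,
    ← div_eq_mul_inv _ α] at h1
  simpa using (ENNReal.div_le_iff hα0.ne' hα.ne).1 h1

/-- A lower bound for `|g|` on a cube bounds its Zygmund–Morrey norm from below. -/
lemma ofReal_mul_le_zygmundMorreyNorm (hn : n ≠ 0) {lam : ℝ}
    (g : EuclideanSpace ℝ (Fin n) → EReal) {a : EuclideanSpace ℝ (Fin n)} {r : ℝ} (hr : 0 < r)
    {m : ℝ≥0∞} (h : ∀ᵐ x, x ∈ axisCube a r → m ≤ (g x).abs) :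
    ENNReal.ofReal ((2 * r) ^ lam) * m ≤ zygmundMorreyNorm lam g := by
  have hn0 : (n : ℝ) ≠ 0 := by exact_mod_cast hn
  have h1 : m ≤ zygmundAverage g (axisCube a r) := by
    refine le_trans ?_ (laverage_abs_le_zygmundAverage g _)
    rw [setLAverage_eq, ENNReal.le_div_iff_mul_le (Or.inl (volume_axisCube_ne_zero a hr))
      (Or.inl (volume_axisCube_ne_top a hr)), ← setLIntegral_const]
    exact lintegral_mono_ae ((ae_restrict_iff' (isOpen_axisCube a r).measurableSet).2 h)
  have h2 : volume (axisCube a r) ^ (lam / n) = ENNReal.ofReal ((2 * r) ^ lam) := by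
    rw [volume_axisCube a hr, ENNReal.ofReal_rpow_of_pos (by positivity), ← Real.rpow_natCast,
      ← Real.rpow_mul (by positivity), mul_div_cancel₀ _ hn0]
  rw [← h2]
  refine (mul_le_mul' le_rfl h1).trans ?_
  unfold zygmundMorreyNorm
  exact le_iSup₂_of_le a r (le_iSup_of_le hr le_rfl)

/-- Weak `L^(n / lam)` embeds into the Zygmund–Morrey space. -/
lemma exists_zygmundMorreyNorm_le_of_measure_lt_le {lam : ℝ} (hlam : 0 < lam) (hlamn : lam < n) :
    ∃ K : ℝ, 0 < K ∧ ∀ (h : EuclideanSpace ℝ (Fin n) → EReal) (A : ℝ), 0 < A → AEMeasurable h →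
      (∀ t : ℝ, 0 < t → volume {x | ENNReal.ofReal t < (h x).abs} ≤
        ENNReal.ofReal ((A / t) ^ (n / lam))) →
      zygmundMorreyNorm lam h ≤ ENNReal.ofReal (K * A) := by
  have hn0 : (0 : ℝ) < n := hlam.trans hlamn
  set p := n / lam with hp
  have hp1 : 1 < p := by rw [hp, one_lt_div hlam]; exact hlamn
  have hp0 : 0 < p := by linarith
  set q : ℝ := 2 ^ (1 - p) with hq
  have hq1 : ENNReal.ofReal q < 1 := by
    rw [ENNReal.ofReal_lt_one]
    exact Real.rpow_lt_one_of_one_lt_of_neg one_lt_two (by linarith)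
  set Z := ∑' j : ℕ, (1 + (j : ℝ≥0∞)) * ENNReal.ofReal q ^ j with hZ
  have hZtop : Z ≠ ∞ := ENNReal.tsum_one_add_mul_pow_ne_top hq1
  have hZ0 : 0 < Z := by
    refine lt_of_lt_of_le ?_ (ENNReal.le_tsum 0)
    simp
  have hZr : 0 < Z.toReal := ENNReal.toReal_pos hZ0.ne' hZtop
  -- Chosen so that the layers sum to half of `|Q|`. The constant `2⁻¹` of the layer bound takes the
  -- other half.
  set B : ℝ := 2 * 2 ^ p * Z.toReal with hB
  have hB0 : 0 < B := by positivity
  refine ⟨B ^ p⁻¹, by positivity, fun h A hA hm hweak => ?_⟩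
  unfold zygmundMorreyNorm
  refine iSup₂_le fun a r => iSup_le fun hr => ?_
  have h2 : volume (axisCube a r) ^ (lam / n) = ENNReal.ofReal ((2 * r) ^ lam) := by
    rw [volume_axisCube a hr, ENNReal.ofReal_rpow_of_pos (by positivity), ← Real.rpow_natCast,
      ← Real.rpow_mul (by positivity), mul_div_cancel₀ _ hn0.ne']
  -- Scaled so that `|Q| ^ (lam / n) * α = B ^ p⁻¹ * A` for every cube.
  set α : ℝ := B ^ p⁻¹ * A * ((2 * r) ^ lam)⁻¹ with hα
  have hα0 : 0 < α := by positivity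
  have hαp : (A / α) ^ p = B⁻¹ * (2 * r) ^ n := by
    have : A / α = (B ^ p⁻¹)⁻¹ * (2 * r) ^ lam := by rw [hα]; field_simp
    rw [this, Real.mul_rpow (by positivity) (by positivity), Real.inv_rpow (by positivity),
      ← Real.rpow_mul hB0.le, inv_mul_cancel₀ hp0.ne', Real.rpow_one,
      ← Real.rpow_mul (by positivity), hp, mul_div_cancel₀ _ hlam.ne', Real.rpow_natCast]
  rw [h2]
  have key : zygmundAverage h (axisCube a r) ≤ ENNReal.ofReal α := by
    refine sInf_le ⟨by simpa using hα0, ENNReal.ofReal_lt_top, ?_⟩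
    rw [setLAverage_eq, ENNReal.div_le_iff (volume_axisCube_ne_zero a hr)
      (volume_axisCube_ne_top a hr), one_mul]
    have hα0' : ENNReal.ofReal α ≠ 0 := by simpa using hα0
    let S : ℕ → Set (EuclideanSpace ℝ (Fin n)) := fun j =>
      {x | 2 ^ j / 2 < (h x).abs / ENNReal.ofReal α}
    have habs : AEMeasurable (fun x => (h x).abs) := measurable_ereal_abs.comp_aemeasurable hm
    have hS : ∀ j, NullMeasurableSet (S j) := fun j =>
      nullMeasurableSet_lt aemeasurable_const (habs.div_const _)
    have hSvol : ∀ j : ℕ, (2 : ℝ≥0∞) ^ j * (1 + j) * volume (S j) ≤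
        ENNReal.ofReal (2 ^ p * B⁻¹ * (2 * r) ^ n) * ((1 + j) * ENNReal.ofReal q ^ j) := by
      intro j
      have h4 : S j ⊆ {x | ENNReal.ofReal (2 ^ j / 2 * α) < (h x).abs} := by
        intro x hx
        have hx' : 2 ^ j / 2 < (h x).abs / ENNReal.ofReal α := hx
        rw [ENNReal.lt_div_iff_mul_lt (Or.inl hα0') (Or.inl ENNReal.ofReal_ne_top)] at hx'
        rw [mem_ofPred_eq, ENNReal.ofReal_mul (by positivity), ENNReal.ofReal_div_of_pos two_pos,
          ENNReal.ofReal_pow zero_le_two]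
        simpa using hx'
      have h5 : (2 : ℝ≥0∞) ^ j = ENNReal.ofReal (2 ^ j) := by
        rw [ENNReal.ofReal_pow zero_le_two]; simp
      have h6 : (A / (2 ^ j / 2 * α)) ^ p = 2 ^ p * ((2 ^ j) ^ p)⁻¹ * (B⁻¹ * (2 * r) ^ n) := by
        have : A / (2 ^ j / 2 * α) = 2 * (2 ^ j)⁻¹ * (A / α) := by field_simp
        rw [this, Real.mul_rpow (by positivity) (by positivity), hαp,
          Real.mul_rpow (by positivity) (by positivity), Real.inv_rpow (by positivity)]
      have h7 : (2 : ℝ) ^ j * ((2 ^ j) ^ p)⁻¹ = q ^ j := by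
        rw [hq, ← Real.rpow_natCast, ← Real.rpow_natCast, ← Real.rpow_mul zero_le_two,
          ← Real.rpow_mul zero_le_two, ← Real.rpow_neg zero_le_two, ← Real.rpow_add two_pos]
        congr 1; ring
      calc (2 : ℝ≥0∞) ^ j * (1 + j) * volume (S j)
          ≤ ENNReal.ofReal (2 ^ j) * (1 + j) *
            ENNReal.ofReal (2 ^ p * ((2 ^ j) ^ p)⁻¹ * (B⁻¹ * (2 * r) ^ n)) := by
            rw [h5, ← h6]
            gcongr
            exact (measure_mono h4).trans (hweak _ (by positivity))
        _ = (1 + j) * ENNReal.ofReal (2 ^ j *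
              (2 ^ p * ((2 ^ j) ^ p)⁻¹ * (B⁻¹ * (2 * r) ^ n))) := by
            rw [ENNReal.ofReal_mul (p := 2 ^ j) (by positivity)]; ring
        _ = (1 + j) * ENNReal.ofReal (2 ^ p * B⁻¹ * (2 * r) ^ n * q ^ j) := by
            rw [← h7]; congr 2; ring
        _ = _ := by
            rw [ENNReal.ofReal_mul (by positivity), ENNReal.ofReal_pow (by positivity)]; ring
    calc ∫⁻ x in axisCube a r, zygmundYoung ((h x).abs / ENNReal.ofReal α)
        ≤ ∫⁻ x in axisCube a r, (2⁻¹ + ∑' j : ℕ,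
            (S j).indicator (fun _ => (2 : ℝ≥0∞) ^ j * (1 + j)) x) := by
          refine lintegral_mono fun x => (zygmundYoung_le_add_tsum _).trans (le_of_eq ?_)
          simp only [S, indicator_apply, mem_ofPred_eq]
      _ = 2⁻¹ * volume (axisCube a r) + ∑' j : ℕ, ∫⁻ x in axisCube a r,
            (S j).indicator (fun _ => (2 : ℝ≥0∞) ^ j * (1 + j)) x := by
          rw [lintegral_add_left measurable_const, setLIntegral_const, lintegral_tsum]
          exact fun j => (aemeasurable_const.indicator₀ (hS j)).restrict
      _ ≤ 2⁻¹ * volume (axisCube a r) + ∑' j : ℕ,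
            ENNReal.ofReal (2 ^ p * B⁻¹ * (2 * r) ^ n) * ((1 + j) * ENNReal.ofReal q ^ j) := by
          gcongr with j
          refine (setLIntegral_le_lintegral _ _).trans ?_
          rw [lintegral_indicator_const₀ (hS j)]
          exact hSvol j
      _ = 2⁻¹ * volume (axisCube a r) + ENNReal.ofReal (2 ^ p * B⁻¹ * (2 * r) ^ n) * Z := by
          rw [ENNReal.tsum_mul_left]
      _ = 2⁻¹ * volume (axisCube a r) + 2⁻¹ * volume (axisCube a r) := by
          congr 1
          rw [← ENNReal.ofReal_toReal hZtop, ← ENNReal.ofReal_mul (by positivity),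
            volume_axisCube a hr]
          have h2 : (2 : ℝ≥0∞)⁻¹ = ENNReal.ofReal 2⁻¹ := by
            rw [ENNReal.ofReal_inv_of_pos two_pos]; simp
          rw [h2, ← ENNReal.ofReal_mul (by positivity)]
          congr 1
          rw [hB]
          have : (2 : ℝ) ^ p ≠ 0 := by positivity
          field_simp
      _ = volume (axisCube a r) := by rw [← add_mul, ENNReal.inv_two_add_inv_two, one_mul]
  calc ENNReal.ofReal ((2 * r) ^ lam) * zygmundAverage h (axisCube a r)
      ≤ ENNReal.ofReal ((2 * r) ^ lam) * ENNReal.ofReal α := by gcongr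
    _ = ENNReal.ofReal (B ^ p⁻¹ * A) := by
      rw [← ENNReal.ofReal_mul (by positivity), hα]
      congr 1
      field_simp

/-- A radially decreasing function of the Zygmund–Morrey space decays like `|x|^(-lam)`. -/
lemma IsRadiallyDecreasing.abs_le (hn : n ≠ 0) {lam : ℝ} (hlam : 0 < lam)
    {f : EuclideanSpace ℝ (Fin n) → EReal} (hf : IsRadiallyDecreasing f)
    (hfin : zygmundMorreyNorm lam f < ∞) {x : EuclideanSpace ℝ (Fin n)} (hx : x ≠ 0) :
    (f x).abs ≤ ENNReal.ofReal (n ^ lam) * zygmundMorreyNorm lam f * ‖x‖ₑ ^ (-lam) := by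
  obtain ⟨φ, hφ, hfφ⟩ := hf
  have hx0 : 0 < ‖x‖ := norm_pos_iff.2 hx
  have hn0 : (0 : ℝ) < n := by exact_mod_cast Nat.pos_of_ne_zero hn
  have hne : ∀ᵐ y : EuclideanSpace ℝ (Fin n), y ≠ 0 := by
    have : Nonempty (Fin n) := ⟨⟨0, Nat.pos_of_ne_zero hn⟩⟩
    have : Nontrivial (EuclideanSpace ℝ (Fin n)) := inferInstance
    exact compl_mem_ae_iff.2 (measure_singleton 0)
  rcases le_or_gt 0 (f x) with h0 | h0
  · -- a cube centred at the origin
    -- Half-side `‖x‖ / n` keeps the cube inside the ball of radius `‖x‖`, where `f ≥ f x` off the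
    -- origin.
    have h1 := ofReal_mul_le_zygmundMorreyNorm hn (lam := lam) f
      (a := 0) (r := ‖x‖ / n) (by positivity) (m := (f x).abs) (by
        filter_upwards [hne] with y hy hyQ
        have hyx : ‖y‖ ≤ ‖x‖ := by
          have := EuclideanSpace.norm_lt_of_forall_abs_lt hn (v := y) (r := ‖x‖ / n)
            fun i => by simpa using hyQ i
          rw [mul_div_cancel₀ _ hn0.ne'] at this
          exact this.le
        have h2 : f x ≤ f y := by
          rw [hfφ x hx, hfφ y hy]
          exact hφ (norm_pos_iff.2 hy) hx0 hyx
        exact EReal.abs_le_abs_of_nonneg h0 h2)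
    have h3 : ENNReal.ofReal ((2 * (‖x‖ / n)) ^ lam) *
        (ENNReal.ofReal (n ^ lam) * ‖x‖ₑ ^ (-lam)) = ENNReal.ofReal (2 ^ lam) := by
      rw [← ofReal_norm, ENNReal.ofReal_rpow_of_pos hx0, ← ENNReal.ofReal_mul (by positivity),
        ← ENNReal.ofReal_mul (by positivity)]
      congr 1
      rw [Real.mul_rpow zero_le_two (by positivity), Real.div_rpow hx0.le hn0.le,
        Real.rpow_neg hx0.le]
      field_simp
    calc (f x).abs ≤ ENNReal.ofReal (2 ^ lam) * (f x).abs := by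
          refine le_mul_of_one_le_left' ?_
          rw [ENNReal.one_le_ofReal]
          exact Real.one_le_rpow one_le_two hlam.le
      _ = ENNReal.ofReal (n ^ lam) * (ENNReal.ofReal ((2 * (‖x‖ / n)) ^ lam) * (f x).abs) *
          ‖x‖ₑ ^ (-lam) := by rw [← h3]; ring
      _ ≤ _ := by gcongr
  · -- far away cubes show that `f` cannot be negative
    exfalso
    have hm0 : (f x).abs ≠ 0 := fun h => h0.ne (EReal.abs_eq_zero_iff.1 h)
    have h1 : ∀ R : ℝ, 0 < R →
        ENNReal.ofReal ((2 * R) ^ lam) * (f x).abs ≤ zygmundMorreyNorm lam f := by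
      intro R hR
      let i₀ : Fin n := ⟨0, Nat.pos_of_ne_zero hn⟩
      -- On this cube one coordinate exceeds `‖x‖`, so `f ≤ f x < 0` there, while `R` is arbitrary.
      refine ofReal_mul_le_zygmundMorreyNorm hn f (a := EuclideanSpace.single i₀ (R + ‖x‖)) hR ?_
      filter_upwards [hne] with y hy hyQ
      have h2 : ‖x‖ ≤ ‖y‖ := by
        have h3 := hyQ i₀
        have h4 := PiLp.norm_apply_le y i₀
        rw [Real.norm_eq_abs] at h4
        simp only [PiLp.single_apply, if_true] at h3
        rw [abs_lt] at h3
        have := le_abs_self (y i₀)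
        linarith
      have h3 : f y ≤ f x := by
        rw [hfφ x hx, hfφ y hy]
        exact hφ hx0 (norm_pos_iff.2 hy) h2
      exact EReal.abs_le_abs_of_nonpos h0.le h3
    have h2 : Tendsto (fun R : ℝ => ENNReal.ofReal ((2 * R) ^ lam) * (f x).abs) atTop (𝓝 ∞) := by
      have h3 : Tendsto (fun R : ℝ => (2 * R) ^ lam) atTop atTop :=
        (tendsto_rpow_atTop hlam).comp (tendsto_id.const_mul_atTop two_pos)
      have h4 := ENNReal.Tendsto.mul_const (b := (f x).abs)
        (ENNReal.tendsto_ofReal_atTop.comp h3) (Or.inl ENNReal.top_ne_zero)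
      rwa [ENNReal.top_mul hm0] at h4
    have h3 := le_of_tendsto h2 (by filter_upwards [eventually_gt_atTop 0] with R hR using h1 R hR)
    exact absurd hfin (not_lt.2 h3)

end ZygmundMorrey

/-! ### Pointwise bounds for the commutator. -/

section Commutator

variable {n : ℕ}

/-- Lower semicontinuity: cubes are open, so a cube that witnesses a value at `x` does so at all of
its points. No measurability of `f` is needed. -/
lemma measurable_cubeMaximal (f : EuclideanSpace ℝ (Fin n) → EReal) :
    Measurable (cubeMaximal f) := by
  refine measurable_of_Ioi fun t => IsOpen.measurableSet (isOpen_iff_mem_nhds.2 fun x hx => ?_)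
  simp only [cubeMaximal, mem_preimage, mem_Ioi, lt_iSup_iff] at hx
  obtain ⟨a, r, hr, hxa, h⟩ := hx
  filter_upwards [(isOpen_axisCube a r).mem_nhds hxa] with y hy
  simp only [cubeMaximal, mem_preimage, mem_Ioi, lt_iSup_iff]
  exact ⟨a, r, hr, hy, h⟩

lemma aemeasurable_maximalCommutator {b : EuclideanSpace ℝ (Fin n) → ℝ} (hb : AEMeasurable b)
    (f : EuclideanSpace ℝ (Fin n) → EReal) : AEMeasurable (maximalCommutator b f) := by
  unfold maximalCommutator
  simp only [sub_eq_add_neg]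
  have h1 := (measurable_cubeMaximal fun y => (b y : EReal) * f y).coe_ereal_ennreal
  have h2 := (measurable_cubeMaximal f).coe_ereal_ennreal
  have h3 : AEMeasurable fun x => (b x : EReal) := hb.coe_real_ereal
  exact h1.aemeasurable.add
    (continuous_neg.measurable.comp_aemeasurable (h3.mul h2.aemeasurable))

/-- On each cube the means of `|b| |f|` and `|b x| |f|` differ by at most `C`, hence so do the
suprema. Replacing `|b x|` by `b x` gives the second term. -/
lemma abs_maximalCommutator_le {b : EuclideanSpace ℝ (Fin n) → ℝ}
    (hb : AEMeasurable b) {f : EuclideanSpace ℝ (Fin n) → EReal} (hf : AEMeasurable f)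
    {x : EuclideanSpace ℝ (Fin n)} {C : ℝ≥0∞} (hC : C ≠ ∞) (hM : cubeMaximal f x ≠ ∞)
    (h : ∀ a r, 0 < r → x ∈ axisCube a r →
      ⨍⁻ y in axisCube a r, ‖|b y| - |b x|‖ₑ * (f y).abs ∂volume ≤ C) :
    (maximalCommutator b f x).abs ≤ C + ‖|b x| - b x‖ₑ * cubeMaximal f x := by
  have hF : AEMeasurable fun y => (f y).abs := measurable_ereal_abs.comp_aemeasurable hf
  have habs : ∀ y, ((b y : EReal) * f y).abs = ‖b y‖ₑ * (f y).abs := by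
    intro y
    rw [EReal.abs_mul, EReal.abs_def, ← Real.norm_eq_abs, ofReal_norm]
  have hbb : ∀ u v : ℝ, ‖u‖ₑ ≤ ‖|u| - |v|‖ₑ + ‖v‖ₑ := by
    intro u v
    rw [← Real.enorm_abs u, ← Real.enorm_abs v]
    have : |u| = (|u| - |v|) + |v| := by ring
    conv_lhs => rw [this]
    exact enorm_add_le _ _
  set m := cubeMaximal f x with hm
  set Mb := cubeMaximal (fun y => (b y : EReal) * f y) x with hMb
  have h1 : Mb ≤ C + ‖b x‖ₑ * m := by
    refine iSup₂_le fun a r => iSup₂_le fun hr hx => ?_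
    calc ⨍⁻ y in axisCube a r, ((b y : EReal) * f y).abs ∂volume
        ≤ ⨍⁻ y in axisCube a r, ‖|b y| - |b x|‖ₑ * (f y).abs ∂volume +
          ‖b x‖ₑ * ⨍⁻ y in axisCube a r, (f y).abs ∂volume := by
          simp only [setLAverage_eq, habs]
          rw [← mul_div_assoc, ← ENNReal.add_div]
          gcongr
          rw [← lintegral_const_mul' _ _ enorm_ne_top,
            ← lintegral_add_right' _ (hF.restrict.const_mul _)]
          refine lintegral_mono fun y => ?_
          simp only
          rw [← add_mul]
          gcongr
          exact hbb _ _
      _ ≤ C + ‖b x‖ₑ * m := by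
          gcongr
          · exact h a r hr hx
          · exact le_iSup₂_of_le a r (le_iSup₂_of_le hr hx le_rfl)
  have h2 : ‖b x‖ₑ * m ≤ Mb + C := by
    rw [hm, cubeMaximal]
    simp only [ENNReal.mul_iSup]
    refine iSup₂_le fun a r => iSup₂_le fun hr hx => ?_
    calc ‖b x‖ₑ * ⨍⁻ y in axisCube a r, (f y).abs ∂volume
        ≤ ⨍⁻ y in axisCube a r, ((b y : EReal) * f y).abs ∂volume +
          ⨍⁻ y in axisCube a r, ‖|b y| - |b x|‖ₑ * (f y).abs ∂volume := by
          simp only [setLAverage_eq, habs]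
          rw [← mul_div_assoc, ← ENNReal.add_div]
          gcongr
          rw [← lintegral_const_mul' _ _ enorm_ne_top]
          rw [← lintegral_add_left' (by exact (hb.enorm.mul hF).restrict)]
          refine lintegral_mono fun y => ?_
          simp only
          rw [← add_mul]
          gcongr
          rw [add_comm, enorm_sub_rev]
          exact hbb _ _
      _ ≤ Mb + C := by
          gcongr
          · exact le_iSup₂_of_le a r (le_iSup₂_of_le hr hx le_rfl)
          · exact h a r hr hx
  have hMb' : Mb ≠ ∞ :=
    ne_top_of_le_ne_top (ENNReal.add_ne_top.2 ⟨hC, ENNReal.mul_ne_top enorm_ne_top hM⟩) h1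
  -- Both maximal functions are finite at `x`, so no `∞ - ∞` occurs and the estimate is one between
  -- reals.
  have e1 : maximalCommutator b f x = ((Mb.toReal - b x * m.toReal : ℝ) : EReal) := by
    unfold maximalCommutator
    rw [← hm, ← hMb, ← EReal.coe_ennreal_toReal hMb', ← EReal.coe_ennreal_toReal hM]
    push_cast
    rfl
  have h1' : Mb.toReal ≤ C.toReal + |b x| * m.toReal := by
    have := ENNReal.toReal_mono
      (ENNReal.add_ne_top.2 ⟨hC, ENNReal.mul_ne_top enorm_ne_top hM⟩) h1
    rwa [ENNReal.toReal_add hC (ENNReal.mul_ne_top enorm_ne_top hM), ENNReal.toReal_mul,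
      toReal_enorm, Real.norm_eq_abs] at this
  have h2' : |b x| * m.toReal ≤ Mb.toReal + C.toReal := by
    have := ENNReal.toReal_mono (ENNReal.add_ne_top.2 ⟨hMb', hC⟩) h2
    rwa [ENNReal.toReal_add hMb' hC, ENNReal.toReal_mul, toReal_enorm, Real.norm_eq_abs] at this
  have e2 : C + ‖|b x| - b x‖ₑ * m =
      ENNReal.ofReal (C.toReal + |(|b x| - b x)| * m.toReal) := by
    rw [ENNReal.ofReal_add ENNReal.toReal_nonneg (by positivity), ENNReal.ofReal_toReal hC,
      ENNReal.ofReal_mul (abs_nonneg _), ENNReal.ofReal_toReal hM, Real.enorm_eq_ofReal_abs]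
  rw [e1, e2, EReal.abs_def]
  refine ENNReal.ofReal_le_ofReal ?_
  have h3 : Mb.toReal - b x * m.toReal =
      (Mb.toReal - |b x| * m.toReal) + (|b x| - b x) * m.toReal := by ring
  rw [h3]
  refine (abs_add_le _ _).trans (add_le_add ?_ ?_)
  · rw [abs_le]; constructor <;> linarith
  · rw [abs_mul, abs_of_nonneg (ENNReal.toReal_nonneg (a := m))]

/-- `|w| = w⁺ + w⁻`, and two numbers of `[0, B]` differ by at most `B`. -/
lemma enorm_abs_sub_abs_le {u v : ℝ} {B : ℝ≥0∞} (hu : ‖max (-u) 0‖ₑ ≤ B)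
    (hv : ‖max (-v) 0‖ₑ ≤ B) : ‖|u| - |v|‖ₑ ≤ ‖max u 0 - max v 0‖ₑ + B := by
  have e : ∀ w : ℝ, |w| = max w 0 + max (-w) 0 := fun w => by
    rcases le_total 0 w with h | h
    · rw [abs_of_nonneg h, max_eq_left h, max_eq_right (by linarith), add_zero]
    · rw [abs_of_nonpos h, max_eq_right h, max_eq_left (by linarith), zero_add]
  have h1 : |u| - |v| = (max u 0 - max v 0) + (max (-u) 0 - max (-v) 0) := by
    rw [e u, e v]; ring
  rw [h1]
  refine (enorm_add_le _ _).trans (add_le_add le_rfl (le_trans ?_ (max_le hu hv)))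
  have hu0 : 0 ≤ max (-u) 0 := le_max_right _ _
  have hv0 : 0 ≤ max (-v) 0 := le_max_right _ _
  rw [Real.enorm_eq_ofReal_abs, Real.enorm_eq_ofReal hu0, Real.enorm_eq_ofReal hv0,
    ← ENNReal.ofReal_max]
  refine ENNReal.ofReal_le_ofReal ?_
  rw [abs_le]
  constructor
  · have := le_max_right (max (-u) 0) (max (-v) 0); linarith
  · have := le_max_left (max (-u) 0) (max (-v) 0); linarith

lemma enorm_abs_sub_self_le {u : ℝ} {B : ℝ≥0∞} (hu : ‖max (-u) 0‖ₑ ≤ B) :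
    ‖|u| - u‖ₑ ≤ 2 * B := by
  have e : |u| - u = max (-u) 0 + max (-u) 0 := by
    rcases le_total 0 u with h | h
    · rw [abs_of_nonneg h, max_eq_right (by linarith)]; ring
    · rw [abs_of_nonpos h, max_eq_left (by linarith)]; ring
  rw [e, two_mul]
  exact (enorm_add_le _ _).trans (add_le_add hu hu)

/-- The weighted oscillation bound handles `b⁺` and the `A₁` property handles `b⁻`. The null set is
chosen before `ρ` and `τ`, so one null set serves all levels. -/
lemma exists_abs_maximalCommutator_le (hn : n ≠ 0) {lam : ℝ} (hlam : 0 < lam) (hlamn : lam < n) :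
    ∃ K : ℝ≥0∞, K ≠ ∞ ∧ ∀ (b : EuclideanSpace ℝ (Fin n) → ℝ)
      (c : EuclideanSpace ℝ (Fin n) → ℝ → ℝ) (f : EuclideanSpace ℝ (Fin n) → EReal) (D N : ℝ≥0∞),
      AEMeasurable b → LocallyIntegrable (fun y => max (b y) 0) →
      HasMeanOscillation volume (fun y => max (b y) 0) c D → D ≠ ∞ → N ≠ ∞ →
      (∀ᵐ y, ‖max (-b y) 0‖ₑ ≤ D) → AEMeasurable f →
      (∀ᵐ y, (f y).abs ≤ N * ‖y‖ₑ ^ (-lam)) →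
      ∀ᵐ x, ∀ ρ τ : ℝ, 0 < τ → ‖x‖ < ρ → ρ ≤ 2 * ‖x‖ →
        x ∉ largeOscillationSet volume (fun y => max (b y) 0) c D 0 ρ (ENNReal.ofReal τ) →
        (maximalCommutator b f x).abs ≤ K * N * D * (ENNReal.ofReal τ + 1) * ‖x‖ₑ ^ (-lam) := by
  have : Nonempty (Fin n) := ⟨⟨0, Nat.pos_of_ne_zero hn⟩⟩
  have hnt : Nontrivial (EuclideanSpace ℝ (Fin n)) := inferInstance
  have hlamn' : lam < finrank ℝ (EuclideanSpace ℝ (Fin n)) := by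
    rwa [finrank_euclideanSpace_fin]
  obtain ⟨K₁, hK₁, hosc⟩ := exists_lintegral_enorm_sub_mul_rpow_le
    (volume : Measure (EuclideanSpace ℝ (Fin n))) hlam hlamn'
  obtain ⟨K₂, hK₂, hw⟩ := exists_lintegral_rpow_le
    (volume : Measure (EuclideanSpace ℝ (Fin n))) hlam hlamn'
  set G := ENNReal.ofReal (n ^ n) * volume (ball (0 : EuclideanSpace ℝ (Fin n)) 1) with hG
  have hGtop : G ≠ ∞ := ENNReal.mul_ne_top ENNReal.ofReal_ne_top measure_ball_lt_top.ne
  -- `K₁ + K₂` comes from the means and `2 * K₂` from `2 b⁻(x) Mf(x)`.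
  refine ⟨G * (K₁ + 3 * K₂), ENNReal.mul_ne_top hGtop (ENNReal.add_ne_top.2
    ⟨hK₁, ENNReal.mul_ne_top (by norm_num) hK₂⟩), ?_⟩
  intro b c f D N hb hβ hmo hD hN hneg hf hfN
  have hne : ∀ᵐ y : EuclideanSpace ℝ (Fin n), y ≠ 0 :=
    compl_mem_ae_iff.2 (measure_singleton 0)
  filter_upwards [ae_frequently_lintegral_enorm_sub_le hβ, hneg, hne]
    with x hleb hxneg hx0 ρ τ hτ hxρ hρx hxV
  set w := ‖x‖ₑ ^ (-lam) with hwdef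
  have hwtop : w ≠ ∞ := by
    rw [hwdef, ← ofReal_norm, ENNReal.ofReal_rpow_of_pos (norm_pos_iff.2 hx0)]
    exact ENNReal.ofReal_ne_top
  set θ := ENNReal.ofReal τ + 1 with hθ
  have hθtop : θ ≠ ∞ := ENNReal.add_ne_top.2 ⟨ENNReal.ofReal_ne_top, ENNReal.one_ne_top⟩
  have hθ1 : 1 ≤ θ := le_add_self
  have hmax : cubeMaximal f x ≤ G * (N * (K₂ * w)) := by
    refine iSup₂_le fun a r => iSup₂_le fun hr hx => ?_
    refine setLAverage_axisCube_le hn (fun s hs => ?_) hr hx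
    calc ∫⁻ y in ball x s, (f y).abs ≤ ∫⁻ y in ball x s, N * ‖y‖ₑ ^ (-lam) :=
          lintegral_mono_ae (ae_restrict_of_ae hfN)
      _ = N * ∫⁻ y in ball x s, ‖y‖ₑ ^ (-lam) := lintegral_const_mul' _ _ hN
      _ ≤ N * (K₂ * w * volume (ball x s)) := by gcongr; exact hw x hx0 s hs
      _ = _ := by ring
  have hmean : ∀ a r, 0 < r → x ∈ axisCube a r →
      ⨍⁻ y in axisCube a r, ‖|b y| - |b x|‖ₑ * (f y).abs ∂volume ≤
        G * (N * ((K₁ + K₂) * (θ * D) * w)) := by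
    intro a r hr hx
    refine setLAverage_axisCube_le hn (fun s hs => ?_) hr hx
    calc ∫⁻ y in ball x s, ‖|b y| - |b x|‖ₑ * (f y).abs
        ≤ ∫⁻ y in ball x s, N * (‖max (b y) 0 - max (b x) 0‖ₑ * ‖y‖ₑ ^ (-lam) +
            D * ‖y‖ₑ ^ (-lam)) := by
          refine lintegral_mono_ae (ae_restrict_of_ae ?_)
          filter_upwards [hfN, hneg] with y hy1 hy2
          calc ‖|b y| - |b x|‖ₑ * (f y).abs
              ≤ (‖max (b y) 0 - max (b x) 0‖ₑ + D) * (N * ‖y‖ₑ ^ (-lam)) := by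
                gcongr
                exact enorm_abs_sub_abs_le hy2 hxneg
            _ = _ := by ring
      _ = N * ((∫⁻ y in ball x s, ‖max (b y) 0 - max (b x) 0‖ₑ * ‖y‖ₑ ^ (-lam)) +
            D * ∫⁻ y in ball x s, ‖y‖ₑ ^ (-lam)) := by
          rw [lintegral_const_mul' _ _ hN, lintegral_add_right _ (by fun_prop),
            lintegral_const_mul' _ _ hD]
      _ ≤ N * (K₁ * (θ * D) * w * volume (ball x s) + D * (K₂ * w * volume (ball x s))) := by
          gcongr
          · exact hosc _ c D hβ.aestronglyMeasurable.aemeasurable hmo x ρ _ hxρ hρx hleb hxV s hs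
          · exact hw x hx0 s hs
      _ = N * (K₁ * (θ * D) * w * volume (ball x s) + (1 * D) * (K₂ * w * volume (ball x s))) := by
          rw [one_mul]
      _ ≤ N * (K₁ * (θ * D) * w * volume (ball x s) + (θ * D) * (K₂ * w * volume (ball x s))) := by
          gcongr
      _ = _ := by ring
  have hCtop : G * (N * ((K₁ + K₂) * (θ * D) * w)) ≠ ∞ := by finiteness
  have hMtop : cubeMaximal f x ≠ ∞ := ne_top_of_le_ne_top (by finiteness) hmax
  calc (maximalCommutator b f x).abs
      ≤ G * (N * ((K₁ + K₂) * (θ * D) * w)) + ‖|b x| - b x‖ₑ * cubeMaximal f x :=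
        abs_maximalCommutator_le hb hf hCtop hMtop hmean
    _ ≤ G * (N * ((K₁ + K₂) * (θ * D) * w)) + (2 * (θ * D)) * (G * (N * (K₂ * w))) := by
        gcongr
        exact (enorm_abs_sub_self_le hxneg).trans (by
          gcongr; exact le_mul_of_one_le_left' hθ1)
    _ = _ := by ring

end Commutator

/-! ### From the BMO seminorm on cubes to mean oscillation on balls. -/

section BMO

variable {n : ℕ}

lemma MeasureTheory.LocallyIntegrable.integrableOn_axisCube {b : EuclideanSpace ℝ (Fin n) → ℝ}
    (hb : LocallyIntegrable b) (a : EuclideanSpace ℝ (Fin n)) (r : ℝ) :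
    IntegrableOn b (axisCube a r) := by
  refine (hb.integrableOn_isCompact (isCompact_closedBall a (n * r))).mono_set fun y hy => ?_
  rcases eq_or_ne n 0 with rfl | hn
  · simp [Subsingleton.elim y a]
  · rw [mem_closedBall, dist_eq_norm]
    exact (EuclideanSpace.norm_lt_of_forall_abs_lt hn (v := y - a) fun i => by
      simpa using hy i).le

/-- The average deviates from `u` by at most the mean of `|g - u|`, so it is optimal up to a factor
2. -/
lemma lintegral_enorm_sub_average_le {α : Type*} [MeasurableSpace α] {μ : Measure α} {s : Set α}
    (hs0 : μ s ≠ 0) (hs : μ s ≠ ∞) {g : α → ℝ} (hg : IntegrableOn g s μ) (u : ℝ) :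
    ∫⁻ y in s, ‖g y - ⨍ z in s, g z ∂μ‖ₑ ∂μ ≤ 2 * ∫⁻ y in s, ‖g y - u‖ₑ ∂μ := by
  refine (lintegral_enorm_sub_le_add g s _ u).trans ?_
  rw [two_mul]
  gcongr
  have hsr : (μ s).toReal ≠ 0 := (ENNReal.toReal_pos hs0 hs).ne'
  have h1 : ∫ z in s, (u - g z) ∂μ = (μ s).toReal * (u - ⨍ z in s, g z ∂μ) := by
    have hu : Integrable (fun _ : α => u) (μ.restrict s) := integrableOn_const hs
    rw [integral_sub hu hg, setIntegral_const, setAverage_eq]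
    simp only [smul_eq_mul, Measure.real]
    field_simp
  have h2 := enorm_integral_le_lintegral_enorm (μ := μ.restrict s) fun z => u - g z
  rw [h1, enorm_mul, Real.enorm_eq_ofReal ENNReal.toReal_nonneg, ENNReal.ofReal_toReal hs,
    mul_comm] at h2
  refine h2.trans (le_of_eq ?_)
  simp only [enorm_sub_rev u]

lemma lintegral_enorm_sub_average_le_bmoSeminorm (b : EuclideanSpace ℝ (Fin n) → ℝ)
    (a : EuclideanSpace ℝ (Fin n)) {r : ℝ} (hr : 0 < r) :
    ∫⁻ y in axisCube a r, ‖b y - ⨍ z in axisCube a r, b z‖ₑ ≤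
      bmoSeminorm b * volume (axisCube a r) := by
  rw [← ENNReal.div_le_iff (volume_axisCube_ne_zero a hr) (volume_axisCube_ne_top a hr),
    ← setLAverage_eq]
  exact le_iSup₂_of_le a r (le_iSup_of_le hr le_rfl)

lemma MeasureTheory.LocallyIntegrable.max_zero {b : EuclideanSpace ℝ (Fin n) → ℝ}
    (hb : LocallyIntegrable b) : LocallyIntegrable fun x => max (b x) 0 :=
  fun x => by
    obtain ⟨s, hs, h⟩ := hb x
    exact ⟨s, hs, h.pos_part⟩

/-- The positive part is 1-Lipschitz. This yields the finiteness of the seminorm of `b⁺` in the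
final bound. -/
lemma bmoSeminorm_max_zero_le {b : EuclideanSpace ℝ (Fin n) → ℝ} (hb : LocallyIntegrable b) :
    bmoSeminorm (fun x => max (b x) 0) ≤ 2 * bmoSeminorm b := by
  refine iSup₂_le fun a r => iSup_le fun hr => ?_
  rw [setLAverage_eq, ENNReal.div_le_iff (volume_axisCube_ne_zero a hr)
    (volume_axisCube_ne_top a hr)]
  refine (lintegral_enorm_sub_average_le (volume_axisCube_ne_zero a hr)
    (volume_axisCube_ne_top a hr) (hb.max_zero.integrableOn_axisCube a r)
    (max (⨍ z in axisCube a r, b z) 0)).trans ?_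
  rw [mul_assoc]
  gcongr
  refine (lintegral_mono fun y => ?_).trans (lintegral_enorm_sub_average_le_bmoSeminorm b a hr)
  rw [Real.enorm_eq_ofReal_abs, Real.enorm_eq_ofReal_abs]
  refine ENNReal.ofReal_le_ofReal ?_
  simpa using abs_max_sub_max_le_max (b y) 0 (⨍ z in axisCube a r, b z) 0

/-- The constant in `hD` is the volume ratio of the circumscribed cube to the ball. -/
lemma hasMeanOscillation_average (b : EuclideanSpace ℝ (Fin n) → ℝ) {D : ℝ≥0∞}
    (hD : ENNReal.ofReal (2 ^ n) * (volume (ball (0 : EuclideanSpace ℝ (Fin n)) 1))⁻¹ *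
      bmoSeminorm b ≤ D) :
    HasMeanOscillation volume b (fun a r => ⨍ z in axisCube a r, b z) D := by
  intro a r hr
  refine (lintegral_mono_set (ball_subset_axisCube a r)).trans
    ((lintegral_enorm_sub_average_le_bmoSeminorm b a hr).trans ?_)
  refine le_trans (le_of_eq ?_) (mul_le_mul' hD le_rfl)
  rw [volume_axisCube a hr, Measure.addHaar_ball_of_pos _ a hr, finrank_euclideanSpace_fin,
    mul_pow, ENNReal.ofReal_mul (by positivity)]
  have h0 : volume (ball (0 : EuclideanSpace ℝ (Fin n)) 1) ≠ 0 :=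
    (measure_ball_pos _ _ one_pos).ne'
  have h1 : volume (ball (0 : EuclideanSpace ℝ (Fin n)) 1) ≠ ∞ := measure_ball_lt_top.ne
  calc bmoSeminorm b * (ENNReal.ofReal (2 ^ n) * ENNReal.ofReal (r ^ n))
      = bmoSeminorm b * (ENNReal.ofReal (2 ^ n) * ENNReal.ofReal (r ^ n)) *
        ((volume (ball (0 : EuclideanSpace ℝ (Fin n)) 1))⁻¹ *
          volume (ball (0 : EuclideanSpace ℝ (Fin n)) 1)) := by
        rw [ENNReal.inv_mul_cancel h0 h1, mul_one]
    _ = _ := by ring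

end BMO

/-! ### Assembly and removal of the nondegeneracy assumptions. -/

section Main

variable {n : ℕ}

/-- The norms are replaced by nonzero majorants `D` and `N`, because the John–Nirenberg step cancels
`D` and the weak-type bound needs a positive constant. -/
lemma exists_zygmundMorreyNorm_maximalCommutator_le (hn : n ≠ 0) {lam : ℝ} (hlam : 0 < lam)
    (hlamn : lam < n) :
    ∃ C : ℝ, 0 < C ∧ ∀ b : EuclideanSpace ℝ (Fin n) → ℝ, LocallyIntegrable b →
      ∀ f : EuclideanSpace ℝ (Fin n) → EReal, IsRadiallyDecreasing f → AEMeasurable f →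
      zygmundMorreyNorm lam f < ∞ → ∀ D N : ℝ≥0∞, D ≠ 0 → D ≠ ∞ → N ≠ 0 → N ≠ ∞ →
      bmoSeminorm (fun x => max (b x) 0) + eLpNorm (fun x => max (-b x) 0) ∞ volume ≤ D →
      zygmundMorreyNorm lam f ≤ N →
      zygmundMorreyNorm lam (maximalCommutator b f) ≤ ENNReal.ofReal C * D * N := by
  have : Nonempty (Fin n) := ⟨⟨0, Nat.pos_of_ne_zero hn⟩⟩
  have hnt : Nontrivial (EuclideanSpace ℝ (Fin n)) := inferInstance
  obtain ⟨K₁, hK₁, hpt⟩ := exists_abs_maximalCommutator_le hn hlam hlamn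
  obtain ⟨K₂, hK₂, hweak⟩ := exists_measure_lt_le_of_forall_notMem
    (volume : Measure (EuclideanSpace ℝ (Fin n))) hlam
  obtain ⟨K₃, hK₃, hzyg⟩ := exists_zygmundMorreyNorm_le_of_measure_lt_le (n := n) hlam hlamn
  -- The summand `1` lets `G * D` bound `b⁻` as well as the oscillation of `b⁺`.
  set G := ENNReal.ofReal (2 ^ n) * (volume (ball (0 : EuclideanSpace ℝ (Fin n)) 1))⁻¹ + 1 with hG
  have hGtop : G ≠ ∞ := ENNReal.add_ne_top.2 ⟨ENNReal.mul_ne_top ENNReal.ofReal_ne_top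
    (ENNReal.inv_ne_top.2 (measure_ball_pos _ _ one_pos).ne'), ENNReal.one_ne_top⟩
  have hG1 : 1 ≤ G := le_add_self
  set H := (K₁ + 1) * ENNReal.ofReal (n ^ lam) * G with hH
  have hn0 : (0 : ℝ) < n := hlam.trans hlamn
  have hHtop : H ≠ ∞ := by finiteness
  have hH0 : H ≠ 0 := by
    refine mul_ne_zero (mul_ne_zero (by simp) ?_) (zero_lt_one.trans_le hG1).ne'
    simpa using by positivity
  refine ⟨K₃ * (K₂ * H.toReal), mul_pos hK₃ (mul_pos hK₂ (ENNReal.toReal_pos hH0 hHtop)), ?_⟩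
  intro b hb f hf hfm hfin D N hD0 hD hN0 hN hDle hNle
  have hGD0 : G * D ≠ 0 := mul_ne_zero (zero_lt_one.trans_le hG1).ne' hD0
  have hGD : G * D ≠ ∞ := ENNReal.mul_ne_top hGtop hD
  have hDG : D ≤ G * D := le_mul_of_one_le_left' hG1
  have hmo := hasMeanOscillation_average (fun x => max (b x) 0) (D := G * D)
    (mul_le_mul' le_self_add (le_self_add.trans hDle))
  have hneg : ∀ᵐ y, ‖max (-b y) 0‖ₑ ≤ G * D := by
    filter_upwards [enorm_ae_le_eLpNormEssSup (fun x => max (-b x) 0) volume] with y hy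
    rw [← eLpNorm_exponent_top] at hy
    exact hy.trans ((le_add_self.trans hDle).trans hDG)
  have hne : ∀ᵐ y : EuclideanSpace ℝ (Fin n), y ≠ 0 :=
    compl_mem_ae_iff.2 (measure_singleton 0)
  have hfN : ∀ᵐ y, (f y).abs ≤ ENNReal.ofReal (n ^ lam) * N * ‖y‖ₑ ^ (-lam) := by
    filter_upwards [hne] with y hy
    exact (hf.abs_le hn hlam hfin hy).trans (by gcongr)
  have hbm : AEMeasurable b := hb.aestronglyMeasurable.aemeasurable
  have hpt' := hpt b _ f (G * D) (ENNReal.ofReal (n ^ lam) * N) hbm hb.max_zero hmo hGD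
    (ENNReal.mul_ne_top ENNReal.ofReal_ne_top hN) hneg hfm hfN
  have hHDN : H * D * N ≠ ∞ := by finiteness
  set M := (H * D * N).toReal with hM
  have hM0 : 0 < M := ENNReal.toReal_pos (mul_ne_zero (mul_ne_zero hH0 hD0) hN0) hHDN
  have hw := hweak (fun x => max (b x) 0) _ (G * D) hb.max_zero.aestronglyMeasurable.aemeasurable
    hmo hGD0 hGD (fun x => (maximalCommutator b f x).abs) M hM0 (by
      filter_upwards [hpt'] with x hx ρ τ hτ h1 h2 h3
      refine (hx ρ τ hτ h1 h2 h3).trans ?_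
      rw [ENNReal.ofReal_mul hM0.le, hM, ENNReal.ofReal_toReal hHDN,
        ENNReal.ofReal_add hτ.le zero_le_one, ENNReal.ofReal_one]
      gcongr ?_ * _ * _
      calc K₁ * (ENNReal.ofReal (n ^ lam) * N) * (G * D)
          ≤ (K₁ + 1) * (ENNReal.ofReal (n ^ lam) * N) * (G * D) := by
            gcongr; exact le_self_add
        _ = H * D * N := by rw [hH]; ring)
  have hz := hzyg (maximalCommutator b f) (K₂ * M) (by positivity)
    (aemeasurable_maximalCommutator hbm f) (fun t ht => by
      have := hw t ht
      rwa [finrank_euclideanSpace_fin] at this)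
  refine hz.trans (le_of_eq ?_)
  have e : M = H.toReal * (D * N).toReal := by
    rw [hM, mul_assoc, ENNReal.toReal_mul]
  have e2 : K₃ * (K₂ * M) = K₃ * (K₂ * H.toReal) * (D * N).toReal := by rw [e]; ring
  rw [e2, ENNReal.ofReal_mul (by positivity), ENNReal.ofReal_toReal (ENNReal.mul_ne_top hD hN),
    mul_assoc]

end Main

theorem mainTheorem9 (n : ℕ) (lam : ℝ) (hlam : 0 < lam) (hlamn : lam < n) :
    ∃ c : ℝ, 0 < c ∧
      ∀ b : EuclideanSpace ℝ (Fin n) → ℝ, MemBMO b →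
        eLpNorm (fun x => max (-b x) 0) ∞ volume < ∞ →
        ∀ f : EuclideanSpace ℝ (Fin n) → EReal,
          IsRadiallyDecreasing f → MemZygmundMorrey lam f →
            MemZygmundMorrey lam (maximalCommutator b f) ∧
            zygmundMorreyNorm lam (maximalCommutator b f) ≤
              ENNReal.ofReal c *
                (bmoSeminorm (fun x => max (b x) 0) +
                  eLpNorm (fun x => max (-b x) 0) ∞ volume) *
                zygmundMorreyNorm lam f := by
  have hn : n ≠ 0 := by
    rintro rfl
    rw [Nat.cast_zero] at hlamn
    linarith
  obtain ⟨C, hC, hmain⟩ := exists_zygmundMorreyNorm_maximalCommutator_le hn hlam hlamn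
  refine ⟨C, hC, fun b hb hneg f hf hfm => ?_⟩
  set X := bmoSeminorm (fun x => max (b x) 0) + eLpNorm (fun x => max (-b x) 0) ∞ volume with hX
  set Y := zygmundMorreyNorm lam f with hY
  have hXtop : X ≠ ∞ := by
    refine ENNReal.add_ne_top.2 ⟨?_, hneg.ne⟩
    exact ne_top_of_le_ne_top (ENNReal.mul_ne_top (by norm_num) hb.2.ne)
      (bmoSeminorm_max_zero_le hb.1)
  have hYtop : Y ≠ ∞ := hfm.2.ne
  -- Perturbing both norms by `ε` and letting `ε → 0` covers the cases where one of them vanishes.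
  have hε : ∀ ε : ℝ, 0 < ε → zygmundMorreyNorm lam (maximalCommutator b f) ≤
      ENNReal.ofReal C * (X + ENNReal.ofReal ε) * (Y + ENNReal.ofReal ε) := by
    intro ε hε
    have hε0 : ENNReal.ofReal ε ≠ 0 := by simpa using hε
    exact hmain b hb.1 f hf hfm.1 hfm.2 _ _ (by simp [hε]) (by finiteness) (by simp [hε])
      (by finiteness) le_self_add le_self_add
  have hle : zygmundMorreyNorm lam (maximalCommutator b f) ≤ ENNReal.ofReal C * X * Y := by
    have h0 : Tendsto (fun ε : ℝ => ENNReal.ofReal ε) (𝓝[>] 0) (𝓝 0) := by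
      have := (ENNReal.continuous_ofReal.tendsto 0).mono_left (nhdsWithin_le_nhds (s := Ioi 0))
      rwa [ENNReal.ofReal_zero] at this
    have h1 : Tendsto (fun ε : ℝ => X + ENNReal.ofReal ε) (𝓝[>] 0) (𝓝 X) := by
      simpa using tendsto_const_nhds.add h0
    have h2 : Tendsto (fun ε : ℝ => Y + ENNReal.ofReal ε) (𝓝[>] 0) (𝓝 Y) := by
      simpa using tendsto_const_nhds.add h0
    have h3 := ENNReal.Tendsto.mul
      (ENNReal.Tendsto.const_mul h1 (Or.inr (ENNReal.ofReal_ne_top (r := C))))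
      (Or.inr hYtop) h2 (Or.inr (ENNReal.mul_ne_top ENNReal.ofReal_ne_top hXtop))
    exact ge_of_tendsto h3 (by filter_upwards [self_mem_nhdsWithin] with ε hε' using hε ε hε')
  refine ⟨⟨aemeasurable_maximalCommutator hb.1.aestronglyMeasurable.aemeasurable f,
    hle.trans_lt ?_⟩, hle⟩
  exact ENNReal.mul_lt_top (ENNReal.mul_lt_top ENNReal.ofReal_lt_top hXtop.lt_top) hYtop.lt_top
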